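/- Identify $\mathbb{R}^2$ with $\mathbb{C}$. Let $\mathbf{D}\subset\mathbb{R}^2$ be a domain (non-empty, open, connected) invariant under all rotations about the origin (e.g. the whole plane, a disc, an annulus), and let $K(\mathbf x,\mathbf y)=K_0(|\mathbf x-\mathbf y|)+K_1(\mathbf x,\mathbf y)$ with $K_0:(0,\infty)\to\mathbb{R}$ differentiable and $K_1:\mathbf D^2\to\mathbb{R}$ such that: - **(A1)** $-K_0'$ is a completely monotone function on $(0,\infty)$ that is not identically zero; here $f:(0,\infty)\to\mathbb{R}$ is completely monotone if $f\in C^\infty$ and $(-1)^nf^{(n)}(t)\ge 0$ for all $t>0$, $n\ge 0$; - **(A2)** $\int_0^1|K_0(t)|\,t^{-\alpha+\alpha^2}\,dt<\infty$ for some $\alpha\in(0,1)$; - **(A3)** $K_1\in C^k(\mathbf D^2)$ for some integer $k\ge 4$; - **(A4)** $K_1(\mathbf x,\mathbf y)=K_1(\mathbf y,\mathbf x)=K_1(\overline{\mathbf x},\overline{\mathbf y})=K_1(e^{i\theta}\mathbf x,e^{i\theta}\mathbf y)$ for all $\mathbf x,\mathbf y\in\mathbf D$, $\theta\in\mathbb{R}$.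 Let $b\in(0,1)$ be such that the closure of the annulus $\{b<|\mathbf x|<1\}$ is a compact subset of $\mathbf D$. Set $$V_b^1=\frac1b\int_0^{2\pi}\!\!\int_b^1\nabla_{\mathbf x}K(b,\rho e^{i\eta})\cdot(1,0)\,\rho\,d\rho\,d\eta,\qquad V_b^2=\int_0^{2\pi}\!\!\int_b^1\nabla_{\mathbf x}K(1,\rho e^{i\eta})\cdot(1,0)\,\rho\,d\rho\,d\eta,$$ and, for $n\in\mathbb{N}^\star$ and $c\in\{b,1\}$, $$\lambda_{n,c}=\int_0^{2\pi}K_0\big(2c|\sin\tfrac\eta2|\big)e^{in\eta}d\eta,\quad \widetilde\lambda_{n,b}=\int_0^{2\pi}K_0(|b-e^{i\eta}|)e^{in\eta}d\eta,$$ $$p_{n,c}=\int_0^{2\pi}K_1(c,ce^{i\eta})e^{in\eta}d\eta,\quad \widetilde p_{n,b}=\int_0^{2\pi}K_1(b,e^{i\eta})e^{in\eta}d\eta$$ (all real), $A_{n,b}=-V_b^1+\lambda_{n,b}+p_{n,b}$, $B_{n,b}=-V_b^2-\lambda_{n,1}-p_{n,1}$, $$\mathbf\Delta_{n,b}=(A_{n,b}-B_{n,b})^2-4(\widetilde\lambda_{n,b}+\widetilde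 p_{n,b})^2,\qquad \Omega^\pm_{n,b}=\frac{A_{n,b}+B_{n,b}}2\pm\frac{\sqrt{\mathbf\Delta_{n,b}}}2 .$$ Suppose $V_b^1\neq V_b^2$. Then there is $N\in\mathbb{N}^\star$ (depending on $b$) such that $\mathbf\Delta_{n,b}>0$ for all $n\ge N$, so that $\Omega^\pm_{n,b}$ are real and distinct, the sequences $(\Omega^+_{n,b})_{n\ge N}$ and $(\Omega^-_{n,b})_{n\ge N}$ are strictly monotone, and: (i) if $V_b^1>V_b^2$, then $(\Omega^+_{n,b})_{n\ge N}$ strictly increases to $-V_b^2$, $(\Omega^-_{n,b})_{n\ge N}$ strictly decreases to $-V_b^1$, and for all $n\ge N$ $$-V_b^1<\Omega^-_{n,b}\le\Omega^-_{N,b}<\Omega^+_{N,b}\le\Omega^+_{n,b}<-V_b^2;$$ (ii) if $V_b^1<V_b^2$, then $(\Omega^+_{n,b})_{n\ge N}$ strictly decreases to $-V_b^1$, $(\Omega^-_{n,b})_{n\ge N}$ strictly increases to $-V_b^2$, and for all $n\ge N$ $$\Omega^-_{N,b}\le\Omega^-_{n,b}<-V_b^2<-V_b^1<\Omega^+_{n,b}\le\Omega^+_{N,b}.$$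 -/

import Mathlib

open Set Filter Topology MeasureTheory
open scoped ContDiff

noncomputable section

namespace ActiveScalar

/-- Complete monotonicity on `(0, ∞)`: `f` is of class `C^∞` there and
`(-1)^n f^{(n)}(t) ≥ 0` for all `t > 0` and all `n`. -/
def CompletelyMonotone (f : ℝ → ℝ) : Prop :=
  ContDiffOn ℝ ∞ f (Ioi 0) ∧ ∀ (n : ℕ) (t : ℝ), 0 < t → 0 ≤ (-1) ^ n * iteratedDeriv n f t

/-- The fluid domain: a planar domain (nonempty, open, connected) invariant under all rotations
about the origin, i.e. the plane, a disc, an annulus, the exterior of a disc, .... -/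
structure IsRadialDomain (D : Set ℂ) : Prop where
  isOpen : IsOpen D
  isConnected : IsConnected D
  rotation : ∀ x ∈ D, ∀ θ : ℝ, Complex.exp (θ * Complex.I) * x ∈ D

/-- `S` is compactly contained in `D`. -/
def CompactlyContained (S D : Set ℂ) : Prop :=
  IsCompact (closure S) ∧ closure S ⊆ D

/-- The annulus `{x : b < |x| < 1}`. -/
def annulus (b : ℝ) : Set ℂ := Metric.ball 0 1 \ Metric.closedBall 0 b

/-- The kernel `K(x, y) = K₀(|x - y|) + K₁(x, y)`. -/
def kernel (K₀ : ℝ → ℝ) (K₁ : ℂ → ℂ → ℝ) (x y : ℂ) : ℝ := K₀ ‖x - y‖ + K₁ x y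

/-- `K₀` is differentiable on `(0, ∞)` and `-K₀'` is a completely monotone function on `(0, ∞)`
which is not identically zero. -/
structure CompleteMonotonicity (K₀ : ℝ → ℝ) : Prop where
  differentiable : DifferentiableOn ℝ K₀ (Ioi 0)
  completelyMonotone : CompletelyMonotone (fun t => -deriv K₀ t)
  nonzero : ∃ t : ℝ, 0 < t ∧ -deriv K₀ t ≠ 0

/-- There is `α ∈ (0, 1)` with `∫₀¹ |K₀(t)| t^{-α+α²} dt < ∞`. -/
def IntegrabilityAssumption (K₀ : ℝ → ℝ) : Prop :=
  ∃ α : ℝ, 0 < α ∧ α < 1 ∧ IntegrableOn (fun t => |K₀ t| * t ^ (-α + α ^ 2)) (Ioo 0 1)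

/-- `K₁` is of class `C^k` on `D × D` for some `k ≥ 4`. -/
def RegularityAssumption (D : Set ℂ) (K₁ : ℂ → ℂ → ℝ) : Prop :=
  ∃ k : ℕ, 4 ≤ k ∧ ContDiffOn ℝ k (fun z : ℂ × ℂ => K₁ z.1 z.2) (D ×ˢ D)

/-- `K₁` is symmetric, and invariant under the reflection across the real axis and under all
rotations. -/
structure SymmetryAssumption (D : Set ℂ) (K₁ : ℂ → ℂ → ℝ) : Prop where
  swap : ∀ x ∈ D, ∀ y ∈ D, K₁ x y = K₁ y x
  reflection : ∀ x ∈ D, ∀ y ∈ D, K₁ (starRingEnd ℂ x) (starRingEnd ℂ y) = K₁ x y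
  rotation : ∀ x ∈ D, ∀ y ∈ D, ∀ θ : ℝ,
    K₁ (Complex.exp (θ * Complex.I) * x) (Complex.exp (θ * Complex.I) * y) = K₁ x y

/-- The four standing assumptions on the kernel. -/
structure KernelAssumptions (D : Set ℂ) (K₀ : ℝ → ℝ) (K₁ : ℂ → ℂ → ℝ) : Prop where
  monotonicity : CompleteMonotonicity K₀
  integrability : IntegrabilityAssumption K₀
  regularity : RegularityAssumption D K₁
  symmetry : SymmetryAssumption D K₁

/-- `(1/r) ∫₀^{2π} ∫_b^1 (∇ₓ K(r, ρ e^{iη}) · (1, 0)) ρ dρ dη`, where `r > 0` stands for the point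
`(r, 0)` of the plane and `∇ₓ K · (1, 0)` is the derivative of `K` in its first argument in the
direction `1 ∈ ℂ`. -/
def angularSpeed (K : ℂ → ℂ → ℝ) (b r : ℝ) : ℝ :=
  (1 / r) * ∫ η in (0 : ℝ)..(2 * Real.pi), ∫ ρ in b..1,
    fderiv ℝ (fun x : ℂ => K x (ρ * Complex.exp (η * Complex.I))) (r : ℂ) 1 * ρ

/-- `V_b^1[0]`. (By rotation invariance of `K` it suffices to take the angle `θ = 0`.) -/
def V1 (K₀ : ℝ → ℝ) (K₁ : ℂ → ℂ → ℝ) (b : ℝ) : ℝ := angularSpeed (kernel K₀ K₁) b b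

/-- `V_b^2[0]`. -/
def V2 (K₀ : ℝ → ℝ) (K₁ : ℂ → ℂ → ℝ) (b : ℝ) : ℝ := angularSpeed (kernel K₀ K₁) b 1

/-- `∫₀^{2π} f(η) e^{inη} dη`. It is only used for functions `f` with `f(2π - η) = f(η)`, for which
the integral is real, so that taking the real part loses nothing. -/
def fourierIntegral (f : ℝ → ℝ) (n : ℕ) : ℝ :=
  (∫ η in (0 : ℝ)..(2 * Real.pi), (f η : ℂ) * Complex.exp (Complex.I * n * η)).re

/-- `λ_{n,b} = ∫ K₀(2b |sin(η/2)|) e^{inη} dη`. -/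
def lam (K₀ : ℝ → ℝ) (n : ℕ) (b : ℝ) : ℝ :=
  fourierIntegral (fun η => K₀ (2 * b * |Real.sin (η / 2)|)) n

/-- `λ̃_{n,b} = ∫ K₀(|b - e^{iη}|) e^{inη} dη`. -/
def lamTilde (K₀ : ℝ → ℝ) (n : ℕ) (b : ℝ) : ℝ :=
  fourierIntegral (fun η => K₀ ‖(b : ℂ) - Complex.exp (η * Complex.I)‖) n

/-- `p_{n,b} = ∫ K₁(b, b e^{iη}) e^{inη} dη`. -/
def p (K₁ : ℂ → ℂ → ℝ) (n : ℕ) (b : ℝ) : ℝ :=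
  fourierIntegral (fun η => K₁ b (b * Complex.exp (η * Complex.I))) n

/-- `p̃_{n,b} = ∫ K₁(b, e^{iη}) e^{inη} dη`. -/
def pTilde (K₁ : ℂ → ℂ → ℝ) (n : ℕ) (b : ℝ) : ℝ :=
  fourierIntegral (fun η => K₁ b (Complex.exp (η * Complex.I))) n

/-- `A_{n,b} = -V_b^1[0] + λ_{n,b} + p_{n,b}`. -/
def A (K₀ : ℝ → ℝ) (K₁ : ℂ → ℂ → ℝ) (n : ℕ) (b : ℝ) : ℝ :=
  -V1 K₀ K₁ b + lam K₀ n b + p K₁ n b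

/-- `B_{n,b} = -V_b^2[0] - λ_{n,1} - p_{n,1}`. -/
def B (K₀ : ℝ → ℝ) (K₁ : ℂ → ℂ → ℝ) (n : ℕ) (b : ℝ) : ℝ :=
  -V2 K₀ K₁ b - lam K₀ n 1 - p K₁ n 1

/-- The discriminant of the dispersion equation
`Ω² - (A_{n,b} + B_{n,b}) Ω + A_{n,b} B_{n,b} + (λ̃_{n,b} + p̃_{n,b})² = 0`. -/
def discriminant (K₀ : ℝ → ℝ) (K₁ : ℂ → ℂ → ℝ) (n : ℕ) (b : ℝ) : ℝ :=
  (A K₀ K₁ n b - B K₀ K₁ n b) ^ 2 - 4 * (lamTilde K₀ n b + pTilde K₁ n b) ^ 2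

/-- `Ω⁺_{n,b}`. -/
def OmegaPlus (K₀ : ℝ → ℝ) (K₁ : ℂ → ℂ → ℝ) (n : ℕ) (b : ℝ) : ℝ :=
  (A K₀ K₁ n b + B K₀ K₁ n b) / 2 + Real.sqrt (discriminant K₀ K₁ n b) / 2

/-- `Ω⁻_{n,b}`. -/
def OmegaMinus (K₀ : ℝ → ℝ) (K₁ : ℂ → ℂ → ℝ) (n : ℕ) (b : ℝ) : ℝ :=
  (A K₀ K₁ n b + B K₀ K₁ n b) / 2 - Real.sqrt (discriminant K₀ K₁ n b) / 2

end ActiveScalar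

end

/-! The off-diagonal terms `lamTilde` and `pTilde` are Fourier coefficients of smooth periodic
functions, hence $O(n^{-4})$, so $\Omega^\pm$ are perturbations of $A$ and $B$. Monotonicity follows
once $\lambda_{n,c}-\lambda_{n+1,c}\ge C n^{-3}$ with $C>0$: the terms $p_{n,c}$ and the root
corrections are $O(n^{-4})$ and cannot spoil such decrements. The limits come from the
Riemann-Lebesgue lemma.

The substitution $\eta=2u$ turns $\lambda_{n,c}$ into $2\int_0^\pi K_0(2c\sin u)\cos(2nu)\,du$.
Bernstein's representation is replaced by an approximation: $z\mapsto K_0(a(1-z))-K_0(a)$ has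
nonnegative derivatives on $[0,1)$, hence equals its Taylor series, and $z=e^{-s/a}$ gives a series
of decaying exponentials in $s$ with nonnegative coefficients (`exists_hasSum_exp`). Since
$a(1-e^{-s/a})\to s$ as $a\to\infty$, it suffices to treat exponentials.

For these, $I_n(a)=\int_0^\pi e^{-a\sin u}\cos(2nu)\,du$ solves an inhomogeneous modified Bessel
equation, and a minimum principle compares $I_n$ and $I_n-I_{n+1}$ with explicit rational functions
(`le_expSinMoment`, `le_expSinMoment_sub`). The result is weakened to $I_n(2cx)-I_{n+1}(2cx)\ge
Cn^{-3}(e^{-xs_1}-e^{-xs_2})$. Being linear in the exponentials, this sums to a lower bound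
$Cn^{-3}(K_0(s_1)-K_0(s_2))$ in `CompleteMonotonicity.le_integral`; $s_1<s_2$ are chosen with
$K_0(s_2)<K_0(s_1)$. -/

namespace ActiveScalar

/-! ### Taylor series of functions with nonnegative derivatives. -/

/-- The derivative of a Taylor remainder is the Taylor remainder of the derivative. -/
theorem hasDerivAt_taylor_remainder (m : ℕ) (F : ℕ → ℝ → ℝ)
    (hd : ∀ j z, z < 1 → HasDerivAt (F j) (F (j + 1) z) z) (t : ℝ) (ht : t < 1) :
    HasDerivAt (fun t => F 0 t - ∑ k ∈ Finset.range (m + 1), F k 0 * t ^ k / k.factorial)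
      (F 1 t - ∑ k ∈ Finset.range m, F (k + 1) 0 * t ^ k / k.factorial) t := by
  refine (hd 0 t ht).sub ?_
  have hk : ∀ k ∈ Finset.range m, HasDerivAt
      (fun t : ℝ => F (k + 1) 0 * t ^ (k + 1) / (k + 1).factorial)
      (F (k + 1) 0 * t ^ k / k.factorial) t := by
    intro k _
    refine (((hasDerivAt_pow (k + 1) t).const_mul (F (k + 1) 0)).div_const
      ((k + 1).factorial : ℝ)).congr_deriv ?_
    rw [Nat.factorial_succ]
    push_cast
    have : ((k.factorial : ℕ) : ℝ) ≠ 0 := by positivity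
    field_simp
  simp only [Finset.sum_range_succ', pow_zero]
  exact (HasDerivAt.fun_sum hk).add_const _

/-- The Taylor remainder of order `m` at `0` of a function with nonnegative derivatives
is nonnegative. -/
theorem taylor_le_of_nonneg (m : ℕ) (F : ℕ → ℝ → ℝ)
    (hd : ∀ j z, z < 1 → HasDerivAt (F j) (F (j + 1) z) z)
    (hF : ∀ j z, 0 ≤ z → z < 1 → 0 ≤ F j z) (z : ℝ) (hz : 0 ≤ z) (hz1 : z < 1) :
    ∑ k ∈ Finset.range m, F k 0 * z ^ k / k.factorial ≤ F 0 z := by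
  induction m generalizing F z with
  | zero => simpa using hF 0 z hz hz1
  | succ m ih =>
    have hder := fun t ht => hasDerivAt_taylor_remainder m F hd t ht
    have hmono : MonotoneOn
        (fun t => F 0 t - ∑ k ∈ Finset.range (m + 1), F k 0 * t ^ k / k.factorial) (Ico 0 1) := by
      refine monotoneOn_of_deriv_nonneg (convex_Ico 0 1)
        (fun t ht => (hder t ht.2).continuousAt.continuousWithinAt)
        (fun t ht => ?_) (fun t ht => ?_)
      · rw [interior_Ico] at ht
        exact (hder t ht.2).differentiableAt.differentiableWithinAt
      · rw [interior_Ico] at ht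
        rw [(hder t ht.2).deriv]
        -- The remainder's derivative is the order-`m` remainder of the shifted family, so the
        -- induction must vary `F`.
        exact sub_nonneg.2 (ih (fun j => F (j + 1)) (fun j z hz => hd (j + 1) z hz)
          (fun j z hz hz1 => hF (j + 1) z hz hz1) t ht.1.le ht.2)
    have h := hmono ⟨le_rfl, zero_lt_one⟩ ⟨hz, hz1⟩ hz
    simp only [Finset.sum_range_succ'] at h
    simp only [Finset.sum_range_succ']
    simp at h ⊢
    exact h

/-- If all derivatives of a function are nonnegative on `[0, 1)`, then the quotient of its Taylor
remainder of order `m` by `z ^ m` is nondecreasing. -/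
theorem taylor_remainder_mul_le (m : ℕ) (F : ℕ → ℝ → ℝ)
    (hd : ∀ j z, z < 1 → HasDerivAt (F j) (F (j + 1) z) z)
    (hF : ∀ j z, 0 ≤ z → z < 1 → 0 ≤ F j z) (r : ℝ) (hr : 0 ≤ r) (hr1 : r ≤ 1)
    (z : ℝ) (hz : 0 ≤ z) (hz1 : z < 1) :
    F 0 (r * z) - ∑ k ∈ Finset.range m, F k 0 * (r * z) ^ k / k.factorial ≤
      r ^ m * (F 0 z - ∑ k ∈ Finset.range m, F k 0 * z ^ k / k.factorial) := by
  induction m generalizing F z with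
  | zero =>
    have hmono : MonotoneOn (F 0) (Ico 0 1) := by
      refine monotoneOn_of_deriv_nonneg (convex_Ico 0 1)
        (fun t ht => (hd 0 t ht.2).continuousAt.continuousWithinAt)
        (fun t ht => ?_) (fun t ht => ?_)
      · rw [interior_Ico] at ht
        exact (hd 0 t ht.2).differentiableAt.differentiableWithinAt
      · rw [interior_Ico] at ht
        rw [(hd 0 t ht.2).deriv]
        exact hF 1 t ht.1.le ht.2
    have hrz : r * z ≤ z := by nlinarith
    simpa using hmono ⟨by positivity, hrz.trans_lt hz1⟩ ⟨hz, hz1⟩ hrz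
  | succ m ih =>
    have hder := fun t ht => hasDerivAt_taylor_remainder m F hd t ht
    set R := fun t => F 0 t - ∑ k ∈ Finset.range (m + 1), F k 0 * t ^ k / k.factorial with hR
    have hrz : ∀ t : ℝ, 0 ≤ t → t < 1 → r * t < 1 := fun t h0 h1 => by nlinarith
    have hder2 : ∀ t, 0 ≤ t → t < 1 → HasDerivAt (fun t => r ^ (m + 1) * R t - R (r * t))
        (r * (r ^ m * (F 1 t - ∑ k ∈ Finset.range m, F (k + 1) 0 * t ^ k / k.factorial) -
          (F 1 (r * t) - ∑ k ∈ Finset.range m, F (k + 1) 0 * (r * t) ^ k / k.factorial))) t := by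
      intro t h0 h1
      have h := ((hder t h1).const_mul (r ^ (m + 1))).sub
        ((hder (r * t) (hrz t h0 h1)).comp t ((hasDerivAt_id t).const_mul r))
      exact h.congr_deriv (by ring)
    have hmono : MonotoneOn (fun t => r ^ (m + 1) * R t - R (r * t)) (Ico 0 1) := by
      refine monotoneOn_of_deriv_nonneg (convex_Ico 0 1)
        (fun t ht => (hder2 t ht.1 ht.2).continuousAt.continuousWithinAt)
        (fun t ht => ?_) (fun t ht => ?_)
      · rw [interior_Ico] at ht
        exact (hder2 t ht.1.le ht.2).differentiableAt.differentiableWithinAt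
      · rw [interior_Ico] at ht
        rw [(hder2 t ht.1.le ht.2).deriv]
        exact mul_nonneg hr (sub_nonneg.2 (ih (fun j => F (j + 1)) (fun j z hz => hd (j + 1) z hz)
          (fun j z hz hz1 => hF (j + 1) z hz hz1) t ht.1.le ht.2))
    have h := hmono ⟨le_rfl, zero_lt_one⟩ ⟨hz, hz1⟩ hz
    have hR0 : R 0 = 0 := by simp [hR, Finset.sum_range_succ']
    simp only [hR0, mul_zero, sub_zero, sub_nonneg] at h
    exact h

/-- A function with nonnegative derivatives on `[0, 1)` is the sum of its Taylor series at `0`. -/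
theorem hasSum_taylor_of_nonneg (F : ℕ → ℝ → ℝ)
    (hd : ∀ j z, z < 1 → HasDerivAt (F j) (F (j + 1) z) z)
    (hF : ∀ j z, 0 ≤ z → z < 1 → 0 ≤ F j z) (z : ℝ) (hz : 0 ≤ z) (hz1 : z < 1) :
    HasSum (fun k => F k 0 * z ^ k / k.factorial) (F 0 z) := by
  have hnn : ∀ z, 0 ≤ z → ∀ k : ℕ, 0 ≤ F k 0 * z ^ k / k.factorial := fun z hz k =>
    div_nonneg (mul_nonneg (hF k 0 le_rfl zero_lt_one) (pow_nonneg hz k)) (Nat.cast_nonneg _)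
  rw [hasSum_iff_tendsto_nat_of_nonneg (hnn z hz)]
  obtain ⟨w, hzw, hw1⟩ := exists_between hz1
  have hw0 : 0 < w := hz.trans_lt hzw
  set r := z / w
  have hr0 : 0 ≤ r := by positivity
  have hr1 : r < 1 := (div_lt_one hw0).2 hzw
  have hrw : r * w = z := div_mul_cancel₀ _ hw0.ne'
  have hlim : Tendsto (fun m : ℕ => F 0 z - r ^ m * F 0 w) atTop (𝓝 (F 0 z)) := by
    simpa using ((tendsto_pow_atTop_nhds_zero_of_lt_one hr0 hr1).mul_const (F 0 w)).const_sub
      (F 0 z)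
  refine tendsto_of_tendsto_of_tendsto_of_le_of_le hlim tendsto_const_nhds (fun m => ?_)
    (fun m => taylor_le_of_nonneg m F hd hF z hz hz1)
  have h := taylor_remainder_mul_le m F hd hF r hr0 hr1.le w hw0.le hw1
  rw [hrw] at h
  have h2 : 0 ≤ r ^ m * ∑ k ∈ Finset.range m, F k 0 * w ^ k / k.factorial :=
    mul_nonneg (pow_nonneg hr0 m) (Finset.sum_nonneg fun k _ => hnn w hw0.le k)
  simp only
  linarith [mul_sub (r ^ m) (F 0 w) (∑ k ∈ Finset.range m, F k 0 * w ^ k / k.factorial)]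

/-! ### Fourier moments of $e^{-a\sin u}$ and the modified Bessel equation. -/

/-- Minimum principle for the operator `(a² + ν) - (a d/da)²` on the half-line. -/
theorem nonneg_of_modifiedBessel_supersolution (ν : ℝ) (hν : 0 ≤ ν) (u u' u'' : ℝ → ℝ)
    (hu : ∀ a, HasDerivAt u (u' a) a) (hu' : ∀ a, HasDerivAt u' (u'' a) a)
    (h0 : u 0 = 0) (hlim : Tendsto u atTop (𝓝 0))
    (hL : ∀ a, 0 < a → a ^ 2 * u'' a + a * u' a ≤ (a ^ 2 + ν) * u a) (a : ℝ) (ha : 0 ≤ a) :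
    0 ≤ u a := by
  by_contra! hneg
  have hcont : Continuous u := continuous_iff_continuousAt.2 fun a => (hu a).continuousAt
  obtain ⟨R, hR⟩ := (hlim.eventually (lt_mem_nhds hneg)).exists_forall_of_atTop
  obtain ⟨m, hm, hmin⟩ := isCompact_Icc.exists_isMinOn (s := Icc 0 (max a R))
    ⟨a, ha, le_max_left _ _⟩ hcont.continuousOn
  have hma : u m ≤ u a := hmin ⟨ha, le_max_left _ _⟩
  have hm0 : 0 < m := by
    rcases hm.1.eq_or_lt with h | h
    · rw [← h, h0] at hma
      linarith
    · exact h
  have hglob : ∀ t, 0 < t → u m ≤ u t := by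
    intro t ht
    rcases le_total t (max a R) with h | h
    · exact hmin ⟨ht.le, h⟩
    · exact hma.trans (hR t ((le_max_right _ _).trans h)).le
  have hloc : IsLocalMin u m := by
    filter_upwards [lt_mem_nhds hm0] with t ht using hglob t ht
  have hd : deriv u = u' := funext fun t => (hu t).deriv
  have h1 : u' m = 0 := (hu m).deriv ▸ hloc.deriv_eq_zero
  -- At an interior negative minimum the first-order term vanishes and the right-hand side of `hL`
  -- is negative.
  have h2 : u'' m < 0 := by
    have h := hL m hm0
    rw [h1, mul_zero, add_zero] at h
    have : (m ^ 2 + ν) * u m < 0 := mul_neg_of_pos_of_neg (by positivity) (by linarith)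
    by_contra! h3
    have : 0 ≤ m ^ 2 * u'' m := by positivity
    linarith
  -- The second-derivative test makes the minimum a local maximum too, so `u` is locally constant
  -- and $u''(m)=0$, a contradiction.
  have hmax : IsLocalMax u m := isLocalMax_of_deriv_deriv_neg
    (by rw [hd, (hu' m).deriv]; exact h2) (by rw [hd, h1]) hcont.continuousAt
  have hconst : u =ᶠ[𝓝 m] fun _ => u m := by
    filter_upwards [hloc, hmax] with t ht ht' using le_antisymm ht' ht
  have h4 := hconst.deriv.deriv_eq
  rw [hd, (hu' m).deriv] at h4
  simp at h4
  linarith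

/-- The moments `∫₀^π e^{-a sin u} (sin u)^j cos(2nu) du`. -/
noncomputable def expSinMoment (n j : ℕ) (a : ℝ) : ℝ :=
  ∫ u in (0 : ℝ)..Real.pi, Real.exp (-(a * Real.sin u)) * Real.sin u ^ j * Real.cos (2 * n * u)

/-- Each derivative in $a$ brings down a factor $-\sin u$, so the moments with `j = 1, 2` supply
$u'$ and $u''$ in the minimum principle. -/
theorem hasDerivAt_expSinMoment (n j : ℕ) (a : ℝ) :
    HasDerivAt (expSinMoment n j) (-expSinMoment n (j + 1) a) a := by
  have h := (intervalIntegral.hasDerivAt_integral_of_dominated_loc_of_deriv_le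
    (μ := volume) (a := 0) (b := Real.pi) (x₀ := a) (s := Metric.ball a 1)
    (F := fun a u => Real.exp (-(a * Real.sin u)) * Real.sin u ^ j * Real.cos (2 * n * u))
    (F' := fun a u => -(Real.exp (-(a * Real.sin u)) * Real.sin u ^ (j + 1) *
      Real.cos (2 * n * u)))
    (bound := fun _ => Real.exp (|a| + 1)) (Metric.ball_mem_nhds a one_pos)
    (Eventually.of_forall fun a => Continuous.aestronglyMeasurable (by fun_prop))
    (Continuous.intervalIntegrable (by fun_prop) _ _)
    (Continuous.aestronglyMeasurable (by fun_prop)) (ae_of_all _ ?_)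
    (by simp) (ae_of_all _ ?_)).2
  · rw [intervalIntegral.integral_neg] at h
    exact h
  · intro u _ x hx
    have hx' : |x| ≤ |a| + 1 := by
      have h1 : |x - a| < 1 := by simpa [Real.dist_eq] using hx
      have h2 := abs_sub_abs_le_abs_sub x a
      linarith
    rw [norm_neg, norm_mul, norm_mul, norm_pow, Real.norm_eq_abs, Real.norm_eq_abs,
      Real.norm_eq_abs, Real.abs_exp]
    have h1 : Real.exp (-(x * Real.sin u)) ≤ Real.exp (|a| + 1) := by
      refine Real.exp_le_exp.2 ((neg_le_abs _).trans ?_)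
      rw [abs_mul]
      exact (mul_le_of_le_one_right (abs_nonneg x) (Real.abs_sin_le_one u)).trans hx'
    have h2 : |Real.sin u| ^ (j + 1) ≤ 1 := pow_le_one₀ (abs_nonneg _) (Real.abs_sin_le_one u)
    calc _ ≤ Real.exp (|a| + 1) * 1 * 1 := by
          gcongr
          exact Real.abs_cos_le_one _
      _ = _ := by ring
  · intro u _ x _
    have he : HasDerivAt (fun x => Real.exp (-(x * Real.sin u)))
        (Real.exp (-(x * Real.sin u)) * -(1 * Real.sin u)) x :=
      (((hasDerivAt_id x).mul_const (Real.sin u)).neg).exp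
    exact ((he.mul_const (Real.sin u ^ j)).mul_const (Real.cos (2 * n * u))).congr_deriv (by ring)

theorem cos_two_nat_mul_pi (n : ℕ) : Real.cos (2 * n * Real.pi) = 1 := by
  have h := Real.cos_nat_mul_two_pi n
  rwa [show (n : ℝ) * (2 * Real.pi) = 2 * n * Real.pi by ring] at h

/-- The inhomogeneous modified Bessel equation. -/
theorem expSinMoment_ode (n : ℕ) (a : ℝ) :
    (a ^ 2 + 4 * n ^ 2) * expSinMoment n 0 a =
      2 * a + (a ^ 2 * expSinMoment n 2 a - a * expSinMoment n 1 a) := by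
  have hint : ∀ j, IntervalIntegrable (fun u => Real.exp (-(a * Real.sin u)) * Real.sin u ^ j *
      Real.cos (2 * n * u)) volume 0 Real.pi := fun j =>
    Continuous.intervalIntegrable (by fun_prop) _ _
  -- An explicit antiderivative encodes two integrations by parts; its boundary values at $0$ and
  -- $\pi$ produce the source $2a$.
  have h := intervalIntegral.integral_eq_sub_of_hasDerivAt (a := 0) (b := Real.pi)
    (f := fun u => -(a * Real.cos u * Real.exp (-(a * Real.sin u)) * Real.cos (2 * n * u)) +
      2 * n * (Real.exp (-(a * Real.sin u)) * Real.sin (2 * n * u)))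
    (f' := fun u => (a ^ 2 + 4 * n ^ 2) * (Real.exp (-(a * Real.sin u)) * Real.sin u ^ 0 *
      Real.cos (2 * n * u)) + a * (Real.exp (-(a * Real.sin u)) * Real.sin u ^ 1 *
      Real.cos (2 * n * u)) - a ^ 2 * (Real.exp (-(a * Real.sin u)) * Real.sin u ^ 2 *
      Real.cos (2 * n * u))) (fun u _ => ?_)
    ((((hint 0).const_mul _).add ((hint 1).const_mul _)).sub ((hint 2).const_mul _))
  · rw [intervalIntegral.integral_sub (((hint 0).const_mul _).add ((hint 1).const_mul _))
      ((hint 2).const_mul _), intervalIntegral.integral_add ((hint 0).const_mul _)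
      ((hint 1).const_mul _)] at h
    simp only [intervalIntegral.integral_const_mul] at h
    have hs : Real.sin (2 * n * Real.pi) = 0 := by
      have h := Real.sin_nat_mul_pi (2 * n)
      push_cast at h
      exact h
    simp only [cos_two_nat_mul_pi, hs, Real.sin_pi, Real.cos_pi, Real.sin_zero, Real.cos_zero,
      mul_zero, neg_zero, Real.exp_zero] at h
    simp only [expSinMoment]
    linarith
  · have hE : HasDerivAt (fun u => Real.exp (-(a * Real.sin u)))
        (Real.exp (-(a * Real.sin u)) * -(a * Real.cos u)) u :=
      (((Real.hasDerivAt_sin u).const_mul a).neg).exp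
    have hl : HasDerivAt (fun u : ℝ => 2 * n * u) (2 * n) u := by
      simpa using (hasDerivAt_id u).const_mul (2 * n : ℝ)
    have h := (((((Real.hasDerivAt_cos u).const_mul a).mul hE).mul hl.cos).neg).add
      ((hE.mul hl.sin).const_mul (2 * n : ℝ))
    refine h.congr_deriv ?_
    have hcs : Real.cos u ^ 2 = 1 - Real.sin u ^ 2 := by
      rw [← Real.sin_sq_add_cos_sq u]
      ring
    simp only [Pi.mul_apply]
    linear_combination (a ^ 2 * Real.exp (-(a * Real.sin u)) * Real.cos (2 * n * u)) * hcs

/-- The boundary condition at $0$ for the minimum principle, read off from the differential equation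
at $a=0$. -/
theorem expSinMoment_zero_zero (n : ℕ) (hn : 1 ≤ n) : expSinMoment n 0 0 = 0 := by
  have h := expSinMoment_ode n 0
  have hn' : (0 : ℝ) < n := by exact_mod_cast hn
  simp only [ne_eq, OfNat.ofNat_ne_zero, not_false_eq_true, zero_pow, zero_add, mul_zero,
    zero_mul, sub_zero, add_zero] at h
  exact (mul_eq_zero.1 h).resolve_left (by positivity)

/-- The boundary condition at infinity: $\sin u>0$ off the endpoints, so the integrand tends to $0$
almost everywhere. -/
theorem tendsto_expSinMoment_atTop (n : ℕ) : Tendsto (expSinMoment n 0) atTop (𝓝 0) := by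
  have h := intervalIntegral.tendsto_integral_filter_of_dominated_convergence
    (μ := volume) (a := 0) (b := Real.pi) (l := (atTop : Filter ℝ))
    (F := fun a u => Real.exp (-(a * Real.sin u)) * Real.sin u ^ 0 * Real.cos (2 * n * u))
    (f := fun _ => 0) (fun _ => 1)
    (Eventually.of_forall fun a => Continuous.aestronglyMeasurable (by fun_prop))
    ?_ (by simp) ?_
  · rw [intervalIntegral.integral_zero] at h
    exact h
  · filter_upwards [eventually_ge_atTop 0] with a ha
    refine ae_of_all _ fun u hu => ?_
    rw [uIoc_of_le Real.pi_pos.le] at hu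
    have hs : 0 ≤ Real.sin u := Real.sin_nonneg_of_nonneg_of_le_pi hu.1.le hu.2
    rw [pow_zero, mul_one, norm_mul, Real.norm_eq_abs, Real.norm_eq_abs, Real.abs_exp]
    exact mul_le_one₀ (Real.exp_le_one_iff.2 (neg_nonpos.2 (mul_nonneg ha hs))) (abs_nonneg _)
      (Real.abs_cos_le_one _)
  · filter_upwards [compl_mem_ae_iff.2 (measure_singleton Real.pi)] with u hu hu'
    rw [uIoc_of_le Real.pi_pos.le] at hu'
    have hs : 0 < Real.sin u := Real.sin_pos_of_pos_of_lt_pi hu'.1 (lt_of_le_of_ne hu'.2 hu)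
    have h1 : Tendsto (fun a => Real.exp (-(a * Real.sin u))) atTop (𝓝 0) :=
      Real.tendsto_exp_neg_atTop_nhds_zero.comp (tendsto_id.atTop_mul_const hs)
    simpa using h1.mul_const (Real.cos (2 * n * u))

/-- The functions $a/(a^2+M)$ and $a/(a^2+M)^2$ are the subsolutions in the two comparison
arguments; here and below are their first two derivatives and their decay. -/
theorem hasDerivAt_div_sq_add (M : ℝ) (hM : 0 < M) (a : ℝ) :
    HasDerivAt (fun a => a / (a ^ 2 + M)) ((M - a ^ 2) / (a ^ 2 + M) ^ 2) a := by
  have hp : a ^ 2 + M ≠ 0 := by positivity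
  refine ((hasDerivAt_id a).fun_div ((hasDerivAt_pow 2 a).add_const M) hp).congr_deriv ?_
  simp only [id]
  field_simp
  norm_num
  ring

theorem hasDerivAt_div_sq_add_deriv (M : ℝ) (hM : 0 < M) (a : ℝ) :
    HasDerivAt (fun a => (M - a ^ 2) / (a ^ 2 + M) ^ 2)
      ((2 * a ^ 3 - 6 * a * M) / (a ^ 2 + M) ^ 3) a := by
  have hp : a ^ 2 + M ≠ 0 := by positivity
  refine (((hasDerivAt_pow 2 a).const_sub M).fun_div
    (((hasDerivAt_pow 2 a).add_const M).fun_pow 2) (by positivity)).congr_deriv ?_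
  field_simp
  norm_num
  ring

theorem hasDerivAt_div_sq_add_sq (M : ℝ) (hM : 0 < M) (a : ℝ) :
    HasDerivAt (fun a => a / (a ^ 2 + M) ^ 2) ((M - 3 * a ^ 2) / (a ^ 2 + M) ^ 3) a := by
  have hp : a ^ 2 + M ≠ 0 := by positivity
  refine ((hasDerivAt_id a).fun_div (((hasDerivAt_pow 2 a).add_const M).fun_pow 2)
    (by positivity)).congr_deriv ?_
  simp only [id]
  field_simp
  norm_num
  ring

theorem hasDerivAt_div_sq_add_sq_deriv (M : ℝ) (hM : 0 < M) (a : ℝ) :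
    HasDerivAt (fun a => (M - 3 * a ^ 2) / (a ^ 2 + M) ^ 3)
      ((12 * a ^ 3 - 12 * a * M) / (a ^ 2 + M) ^ 4) a := by
  have hp : a ^ 2 + M ≠ 0 := by positivity
  refine ((((hasDerivAt_pow 2 a).const_mul 3).const_sub M).fun_div
    (((hasDerivAt_pow 2 a).add_const M).fun_pow 3) (by positivity)).congr_deriv ?_
  field_simp
  norm_num
  ring

theorem tendsto_div_sq_add_atTop (M : ℝ) (hM : 0 < M) :
    Tendsto (fun a : ℝ => a / (a ^ 2 + M)) atTop (𝓝 0) := by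
  refine tendsto_of_tendsto_of_tendsto_of_le_of_le' tendsto_const_nhds
    tendsto_inv_atTop_zero ?_ ?_
  · filter_upwards [eventually_ge_atTop 0] with a ha using by positivity
  · filter_upwards [eventually_gt_atTop 0] with a ha
    rw [div_le_iff₀ (by positivity)]
    field_simp
    linarith

theorem tendsto_div_sq_add_sq_atTop (M : ℝ) (hM : 0 < M) :
    Tendsto (fun a : ℝ => a / (a ^ 2 + M) ^ 2) atTop (𝓝 0) := by
  have h : Tendsto (fun a : ℝ => M⁻¹ * (a / (a ^ 2 + M))) atTop (𝓝 0) := by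
    simpa using (tendsto_div_sq_add_atTop M hM).const_mul M⁻¹
  refine tendsto_of_tendsto_of_tendsto_of_le_of_le' tendsto_const_nhds h ?_ ?_
  · filter_upwards [eventually_ge_atTop 0] with a ha using by positivity
  · filter_upwards [eventually_ge_atTop 0] with a ha
    rw [sq (a ^ 2 + M), ← div_div, div_eq_inv_mul (a / (a ^ 2 + M))]
    gcongr
    nlinarith [sq_nonneg a]

/-- A lower bound for `∫₀^π e^{-a sin u} cos(2nu) du`. -/
theorem le_expSinMoment (n : ℕ) (hn : 1 ≤ n) (a : ℝ) (ha : 0 ≤ a) :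
    2 * (a / (a ^ 2 + (4 * n ^ 2 + 1))) ≤ expSinMoment n 0 a := by
  set M : ℝ := 4 * n ^ 2 + 1 with hM
  have hM0 : 0 < M := by positivity
  have hlim : Tendsto (fun a => expSinMoment n 0 a - 2 * (a / (a ^ 2 + M))) atTop (𝓝 0) := by
    simpa using (tendsto_expSinMoment_atTop n).sub ((tendsto_div_sq_add_atTop M hM0).const_mul 2)
  refine sub_nonneg.1 (nonneg_of_modifiedBessel_supersolution (4 * n ^ 2) (by positivity)
    (fun a => expSinMoment n 0 a - 2 * (a / (a ^ 2 + M)))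
    (fun a => -expSinMoment n 1 a - 2 * ((M - a ^ 2) / (a ^ 2 + M) ^ 2))
    (fun a => -(-expSinMoment n 2 a) - 2 * ((2 * a ^ 3 - 6 * a * M) / (a ^ 2 + M) ^ 3))
    (fun a => (hasDerivAt_expSinMoment n 0 a).sub ((hasDerivAt_div_sq_add M hM0 a).const_mul 2))
    (fun a => (hasDerivAt_expSinMoment n 1 a).neg.sub
      ((hasDerivAt_div_sq_add_deriv M hM0 a).const_mul 2))
    (by simp [expSinMoment_zero_zero n hn])
    hlim (fun a ha => ?_) a ha)
  have hode := expSinMoment_ode n a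
  have hp : 0 < a ^ 2 + M := by positivity
  -- The shift by $1$ in $M=4n^2+1$ makes the defect a multiple of the perfect square $(a^2-M)^2$.
  have key : (a ^ 2 + 4 * n ^ 2) * (a / (a ^ 2 + M)) -
      (a ^ 2 * ((2 * a ^ 3 - 6 * a * M) / (a ^ 2 + M) ^ 3) +
        a * ((M - a ^ 2) / (a ^ 2 + M) ^ 2)) ≤ a := by
    have h4 : (4 * n ^ 2 : ℝ) = M - 1 := by rw [hM]; ring
    rw [h4, ← sub_nonneg]
    have : a - ((a ^ 2 + (M - 1)) * (a / (a ^ 2 + M)) -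
      (a ^ 2 * ((2 * a ^ 3 - 6 * a * M) / (a ^ 2 + M) ^ 3) +
        a * ((M - a ^ 2) / (a ^ 2 + M) ^ 2))) = 2 * a * (a ^ 2 - M) ^ 2 / (a ^ 2 + M) ^ 3 := by
      field_simp
      ring
    rw [this]
    positivity
  linarith

/-- A lower bound for the difference of two consecutive Fourier coefficients of
`e^{-a sin u}`. -/
theorem le_expSinMoment_sub (n : ℕ) (hn : 1 ≤ n) (a : ℝ) (ha : 0 ≤ a) :
    8 * (2 * n + 1) * (a / (a ^ 2 + (4 * (n + 1) ^ 2 + 1)) ^ 2) ≤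
      expSinMoment n 0 a - expSinMoment (n + 1) 0 a := by
  set M : ℝ := 4 * (n + 1) ^ 2 + 1 with hM
  have hM0 : 0 < M := by positivity
  set q : ℝ := 8 * (2 * n + 1) with hq
  have hlim : Tendsto (fun a => expSinMoment n 0 a - expSinMoment (n + 1) 0 a -
      q * (a / (a ^ 2 + M) ^ 2)) atTop (𝓝 0) := by
    have h := (tendsto_expSinMoment_atTop n).sub (tendsto_expSinMoment_atTop (n + 1))
    simpa using h.sub ((tendsto_div_sq_add_sq_atTop M hM0).const_mul q)
  refine sub_nonneg.1 (nonneg_of_modifiedBessel_supersolution (4 * n ^ 2) (by positivity)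
    (fun a => expSinMoment n 0 a - expSinMoment (n + 1) 0 a - q * (a / (a ^ 2 + M) ^ 2))
    (fun a => -expSinMoment n 1 a - -expSinMoment (n + 1) 1 a -
      q * ((M - 3 * a ^ 2) / (a ^ 2 + M) ^ 3))
    (fun a => -(-expSinMoment n 2 a) - -(-expSinMoment (n + 1) 2 a) -
      q * ((12 * a ^ 3 - 12 * a * M) / (a ^ 2 + M) ^ 4))
    (fun a => ((hasDerivAt_expSinMoment n 0 a).sub (hasDerivAt_expSinMoment (n + 1) 0 a)).sub
      ((hasDerivAt_div_sq_add_sq M hM0 a).const_mul q))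
    (fun a => ((hasDerivAt_expSinMoment n 1 a).neg.sub
      (hasDerivAt_expSinMoment (n + 1) 1 a).neg).sub
      ((hasDerivAt_div_sq_add_sq_deriv M hM0 a).const_mul q))
    (by simp [expSinMoment_zero_zero n hn, expSinMoment_zero_zero (n + 1) (by omega)])
    hlim (fun a ha => ?_) a ha)
  -- Subtracting the two equations leaves the source $(4(n+1)^2-4n^2)I_{n+1}=4(2n+1)I_{n+1}$,
  -- bounded below by `le_expSinMoment`; this explains the value of `q`.
  have hode := expSinMoment_ode n a
  have hode' := expSinMoment_ode (n + 1) a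
  push_cast at hode'
  have hlow := le_expSinMoment (n + 1) (by omega) a ha.le
  push_cast at hlow
  rw [← hM] at hlow
  have hp : 0 < a ^ 2 + M := by positivity
  have key : (a ^ 2 + 4 * n ^ 2) * (a / (a ^ 2 + M) ^ 2) -
      (a ^ 2 * ((12 * a ^ 3 - 12 * a * M) / (a ^ 2 + M) ^ 4) +
        a * ((M - 3 * a ^ 2) / (a ^ 2 + M) ^ 3)) ≤ a / (a ^ 2 + M) := by
    have h4 : (4 * n ^ 2 : ℝ) ≤ M - 2 := by
      rw [hM]
      nlinarith [(Nat.cast_nonneg n : (0 : ℝ) ≤ n)]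
    have h5 : (a ^ 2 + 4 * n ^ 2) * (a / (a ^ 2 + M) ^ 2) ≤
        (a ^ 2 + (M - 2)) * (a / (a ^ 2 + M) ^ 2) := by gcongr
    have h6 : a / (a ^ 2 + M) - ((a ^ 2 + (M - 2)) * (a / (a ^ 2 + M) ^ 2) -
      (a ^ 2 * ((12 * a ^ 3 - 12 * a * M) / (a ^ 2 + M) ^ 4) +
        a * ((M - 3 * a ^ 2) / (a ^ 2 + M) ^ 3))) =
        a * (2 * M ^ 2 + 10 * a ^ 4 + (M - 5 * a ^ 2) ^ 2 - 24 * a ^ 4) / (a ^ 2 + M) ^ 4 := by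
      field_simp
      ring
    -- The expression is $3M^2-10Ma^2+11a^4$, a positive definite form in $(M,a^2)$.
    have h7 : 0 ≤ 2 * M ^ 2 + 10 * a ^ 4 + (M - 5 * a ^ 2) ^ 2 - 24 * a ^ 4 := by
      nlinarith [sq_nonneg (M - 5 / 3 * a ^ 2), sq_nonneg (a ^ 2)]
    have h8 := div_nonneg (mul_nonneg ha.le h7) (by positivity : 0 ≤ (a ^ 2 + M) ^ 4)
    linarith
  have h9 : q * (a / (a ^ 2 + M)) ≤ 4 * (2 * n + 1) * expSinMoment (n + 1) 0 a := by
    have := mul_le_mul_of_nonneg_left hlow (by positivity : (0 : ℝ) ≤ 4 * (2 * n + 1))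
    rw [hq]
    linarith
  have h10 := mul_le_mul_of_nonneg_left key (by positivity : 0 ≤ q)
  linarith

/-- The difference of two consecutive Fourier coefficients of `e^{-2cx sin u}` controls
`n^{-3}` times the difference of two exponentials in `x`. -/
theorem exists_exp_sub_exp_le_expSinMoment_sub (c s₁ s₂ : ℝ) (hc : 0 < c) (hs₁ : 0 < s₁)
    (hs : s₁ < s₂) :
    ∃ C : ℝ, 0 < C ∧ ∀ n : ℕ, 1 ≤ n → ∀ x : ℝ, 0 ≤ x →
      C / n ^ 3 * (Real.exp (-(x * s₁)) - Real.exp (-(x * s₂))) ≤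
        expSinMoment n 0 (2 * c * x) - expSinMoment (n + 1) 0 (2 * c * x) := by
  -- From $(17+4c^2x^2)^2\le 2\cdot17^2+2(4c^2x^2)^2$ and $x^4\le 4!\,e^{xs_1}/s_1^4$. The $17$
  -- comes from $4(n+1)^2+1\le17n^2$, an equality at $n=1$.
  set κ : ℝ := 578 + 32 * c ^ 4 * 24 / s₁ ^ 4 with hκ
  have hκ0 : 0 < κ := by positivity
  have hs' : 0 < s₂ - s₁ := sub_pos.2 hs
  refine ⟨32 * c / (2 * κ * (s₂ - s₁)), by positivity, fun n hn x hx => ?_⟩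
  have hn' : (1 : ℝ) ≤ n := by exact_mod_cast hn
  refine le_trans ?_ (le_expSinMoment_sub n hn (2 * c * x) (by positivity))
  have h1 : Real.exp (-(x * s₁)) - Real.exp (-(x * s₂)) ≤
      x * (s₂ - s₁) * Real.exp (-(x * s₁)) := by
    have h := Real.add_one_le_exp (-(x * (s₂ - s₁)))
    have he : Real.exp (-(x * s₂)) = Real.exp (-(x * s₁)) * Real.exp (-(x * (s₂ - s₁))) := by
      rw [← Real.exp_add]
      ring_nf
    rw [he]
    nlinarith [Real.exp_pos (-(x * s₁))]
  have h2 : (17 + 4 * c ^ 2 * x ^ 2) ^ 2 ≤ 2 * κ * Real.exp (x * s₁) := by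
    have h3 := Real.pow_div_factorial_le_exp (x * s₁) (by positivity) 4
    have h4 := Real.one_le_exp (by positivity : 0 ≤ x * s₁)
    have h5 : (17 + 4 * c ^ 2 * x ^ 2) ^ 2 ≤ 578 + 32 * c ^ 4 * x ^ 4 := by
      nlinarith [sq_nonneg (17 - 4 * c ^ 2 * x ^ 2)]
    have h6 : 32 * c ^ 4 * x ^ 4 ≤ κ * Real.exp (x * s₁) := by
      calc 32 * c ^ 4 * x ^ 4 = (32 * c ^ 4 * 24 / s₁ ^ 4) * ((x * s₁) ^ 4 / (4).factorial) := by
            simp only [Nat.factorial]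
            push_cast
            field_simp
        _ ≤ κ * Real.exp (x * s₁) := by
            gcongr
            rw [hκ]
            linarith
    have h7 : 578 ≤ κ * Real.exp (x * s₁) := by
      have : 578 ≤ κ := by
        rw [hκ]
        have : 0 ≤ 32 * c ^ 4 * 24 / s₁ ^ 4 := by positivity
        linarith
      nlinarith
    linarith
  have h3 : Real.exp (-(x * s₁)) ≤ 2 * κ / (17 + 4 * c ^ 2 * x ^ 2) ^ 2 := by
    rw [Real.exp_neg, le_div_iff₀ (by positivity), inv_mul_le_iff₀ (Real.exp_pos _)]
    linarith
  have h4 : (2 * c * x) ^ 2 + (4 * (n + 1) ^ 2 + 1) ≤ n ^ 2 * (17 + 4 * c ^ 2 * x ^ 2) := by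
    have : 0 ≤ ((n : ℝ) ^ 2 - 1) * (4 * c ^ 2 * x ^ 2) :=
      mul_nonneg (by nlinarith) (by positivity)
    nlinarith
  have hne : 17 + 4 * c ^ 2 * x ^ 2 ≠ 0 := by positivity
  calc 32 * c / (2 * κ * (s₂ - s₁)) / n ^ 3 * (Real.exp (-(x * s₁)) - Real.exp (-(x * s₂)))
      ≤ 32 * c / (2 * κ * (s₂ - s₁)) / n ^ 3 *
        (x * (s₂ - s₁) * (2 * κ / (17 + 4 * c ^ 2 * x ^ 2) ^ 2)) := by
        gcongr
        exact h1.trans (by gcongr)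
    _ = 8 * (2 * n) * (2 * c * x / (n ^ 2 * (17 + 4 * c ^ 2 * x ^ 2)) ^ 2) := by
        field_simp
        ring
    _ ≤ 8 * (2 * n + 1) * (2 * c * x / ((2 * c * x) ^ 2 + (4 * (n + 1) ^ 2 + 1)) ^ 2) := by
        gcongr
        linarith

/-! ### Completely monotone kernels as limits of sums of exponentials. -/

theorem contDiffOn_iteratedDeriv_of_isOpen {f : ℝ → ℝ} {s : Set ℝ} (hs : IsOpen s)
    (hf : ContDiffOn ℝ ∞ f s) (j : ℕ) : ContDiffOn ℝ ∞ (iteratedDeriv j f) s := by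
  induction j with
  | zero => simpa using hf
  | succ j ih =>
    rw [iteratedDeriv_succ]
    exact ih.deriv_of_isOpen hs le_rfl

/-- The derivatives of `K₀` on `(0, ∞)`, read off from those of `-K₀'`. -/
noncomputable def kernelDeriv (K₀ : ℝ → ℝ) : ℕ → ℝ → ℝ
  | 0 => K₀
  | j + 1 => fun t => -iteratedDeriv j (fun t => -deriv K₀ t) t

namespace CompleteMonotonicity

variable {K₀ : ℝ → ℝ}

theorem hasDerivAt_kernelDeriv (h : CompleteMonotonicity K₀) (j : ℕ) (t : ℝ) (ht : 0 < t) :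
    HasDerivAt (kernelDeriv K₀ j) (kernelDeriv K₀ (j + 1) t) t := by
  cases j with
  | zero =>
    have hd := ((h.differentiable t ht).differentiableAt (Ioi_mem_nhds ht)).hasDerivAt
    simpa [kernelDeriv] using hd
  | succ j =>
    have hc := contDiffOn_iteratedDeriv_of_isOpen isOpen_Ioi h.completelyMonotone.1 j
    have hd := (((hc.differentiableOn (by simp)) t ht).differentiableAt
      (Ioi_mem_nhds ht)).hasDerivAt.neg
    simp only [kernelDeriv]
    rw [iteratedDeriv_succ]
    exact hd

theorem kernelDeriv_succ_sign (h : CompleteMonotonicity K₀) (j : ℕ) (t : ℝ) (ht : 0 < t) :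
    0 ≤ (-1) ^ (j + 1) * kernelDeriv K₀ (j + 1) t := by
  have := h.completelyMonotone.2 j t ht
  simp only [kernelDeriv]
  rw [pow_succ]
  linarith

theorem continuousOn (h : CompleteMonotonicity K₀) : ContinuousOn K₀ (Ioi 0) :=
  h.differentiable.continuousOn

theorem antitoneOn (h : CompleteMonotonicity K₀) : AntitoneOn K₀ (Ioi 0) := by
  refine antitoneOn_of_deriv_nonpos (convex_Ioi 0) h.continuousOn
    (by rw [interior_Ioi]; exact h.differentiable) fun t ht => ?_
  rw [interior_Ioi] at ht
  have := h.completelyMonotone.2 0 t ht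
  simp at this
  exact this

theorem contDiffOn (h : CompleteMonotonicity K₀) : ContDiffOn ℝ ∞ K₀ (Ioi 0) := by
  rw [contDiffOn_infty_iff_deriv_of_isOpen isOpen_Ioi]
  refine ⟨h.differentiable, ?_⟩
  simpa using h.completelyMonotone.1.neg

/-- If $K_0$ never dropped strictly beyond a point where $K_0'\ne0$, it would be constant to the
right of it, and its right derivative there would vanish. -/
theorem exists_lt (h : CompleteMonotonicity K₀) :
    ∃ s₁ s₂ : ℝ, 0 < s₁ ∧ s₁ < s₂ ∧ K₀ s₂ < K₀ s₁ := by
  obtain ⟨t, ht, hne⟩ := h.nonzero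
  by_contra! hcon
  have hconst : ∀ s, t < s → K₀ s = K₀ t := fun s hs =>
    le_antisymm (h.antitoneOn ht (ht.trans hs) hs.le) (hcon t s ht hs)
  have hd := ((h.differentiable t ht).differentiableAt (Ioi_mem_nhds ht)).hasDerivAt
  have h1 : HasDerivWithinAt K₀ (deriv K₀ t) (Ici t) t := hd.hasDerivWithinAt
  have h2 : HasDerivWithinAt K₀ 0 (Ici t) t :=
    (hasDerivWithinAt_const t (Ici t) (K₀ t)).congr (fun s hs => by
      rcases (mem_Ici.1 hs).eq_or_lt with rfl | hs
      · rfl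
      · exact hconst s hs) rfl
  have := (uniqueDiffWithinAt_Ici t).eq_deriv _ h1 h2
  rw [this] at hne
  simp at hne

/-- Up to a constant, `s ↦ K₀(a(1 - e^{-s/a}))` is a series of decaying exponentials with
nonnegative coefficients. -/
theorem exists_hasSum_exp (h : CompleteMonotonicity K₀) (a : ℝ) (ha : 0 < a) :
    ∃ q : ℕ → ℝ, (∀ j, 0 ≤ q j) ∧ ∀ s, 0 < s →
      HasSum (fun j : ℕ => q j * Real.exp (-(j / a * s)))
        (K₀ (a * (1 - Real.exp (-(s / a)))) - K₀ a) := by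
  -- The successive derivatives of $z\mapsto K_0(a(1-z))-K_0(a)$. The factor $(-a)^j$ absorbs the
  -- alternating signs; subtracting $K_0(a)$ makes the case $j=0$ nonnegative.
  let F : ℕ → ℝ → ℝ := fun j z => (-a) ^ j * kernelDeriv K₀ j (a * (1 - z)) -
    if j = 0 then K₀ a else 0
  have hpos : ∀ z : ℝ, z < 1 → 0 < a * (1 - z) := fun z hz => mul_pos ha (sub_pos.2 hz)
  have hd : ∀ j z, z < 1 → HasDerivAt (F j) (F (j + 1) z) z := by
    intro j z hz
    have hl : HasDerivAt (fun z : ℝ => a * (1 - z)) (-a) z :=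
      (((hasDerivAt_id z).const_sub 1).const_mul a).congr_deriv (by ring)
    have h1 := (((h.hasDerivAt_kernelDeriv j _ (hpos z hz)).comp z hl).const_mul
      ((-a) ^ j)).sub_const (if j = 0 then K₀ a else 0)
    refine h1.congr_deriv ?_
    simp only [F, Nat.succ_ne_zero, if_false]
    ring
  have hF : ∀ j z, 0 ≤ z → z < 1 → 0 ≤ F j z := by
    intro j z hz hz1
    cases j with
    | zero =>
      simp only [F, pow_zero, one_mul, if_true, kernelDeriv, sub_nonneg]
      exact h.antitoneOn (hpos z hz1) ha (by nlinarith)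
    | succ j =>
      simp only [F, Nat.succ_ne_zero, if_false, sub_zero]
      rw [neg_pow, mul_right_comm]
      exact mul_nonneg (h.kernelDeriv_succ_sign j _ (hpos z hz1)) (by positivity)
  refine ⟨fun j => F j 0 / j.factorial,
    fun j => div_nonneg (hF j 0 le_rfl one_pos) (Nat.cast_nonneg _), fun s hs => ?_⟩
  have hz1 : Real.exp (-(s / a)) < 1 := by
    rw [Real.exp_lt_one_iff]
    simp only [Left.neg_neg_iff]
    positivity
  have hsum := hasSum_taylor_of_nonneg F hd hF _ (Real.exp_pos _).le hz1
  have hF0 : F 0 (Real.exp (-(s / a))) = K₀ (a * (1 - Real.exp (-(s / a)))) - K₀ a := by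
    simp [F, kernelDeriv]
  rw [hF0] at hsum
  refine hsum.congr_fun ?_
  intro j
  rw [← Real.exp_nat_mul]
  have : (j : ℝ) * -(s / a) = -(j / a * s) := by ring
  rw [this]
  ring

end CompleteMonotonicity

/-- Equivalent to $e^{s/a}\ge1+s/a$. Together with the upper bound $s$ it gives the limit as
$a\to\infty$ and, for $s\le a$, the bound $s/2$ used for domination. -/
theorem le_mul_one_sub_exp (a s : ℝ) (ha : 0 < a) (hs : 0 < s) :
    a * s / (a + s) ≤ a * (1 - Real.exp (-(s / a))) := by
  have h1 : Real.exp (-(s / a)) ≤ a / (a + s) := by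
    rw [Real.exp_neg, inv_le_comm₀ (Real.exp_pos _) (by positivity), inv_div]
    have := Real.add_one_le_exp (s / a)
    have h2 : (a + s) / a = s / a + 1 := by field_simp; ring
    rw [h2]
    exact this
  have h2 : a * s / (a + s) = a * (1 - a / (a + s)) := by field_simp; ring
  rw [h2]
  gcongr

theorem mul_one_sub_exp_le (a s : ℝ) (ha : 0 < a) : a * (1 - Real.exp (-(s / a))) ≤ s := by
  have h := Real.add_one_le_exp (-(s / a))
  have h1 : a * (1 - Real.exp (-(s / a))) ≤ a * (s / a) := by
    gcongr
    linarith
  rwa [mul_div_cancel₀ _ ha.ne'] at h1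

theorem half_le_mul_one_sub_exp (a s : ℝ) (ha : 0 < a) (hs : 0 < s) (hsa : s ≤ a) :
    s / 2 ≤ a * (1 - Real.exp (-(s / a))) := by
  refine le_trans ?_ (le_mul_one_sub_exp a s ha hs)
  rw [div_le_div_iff₀ two_pos (by positivity)]
  nlinarith

theorem tendsto_mul_one_sub_exp (s : ℝ) (hs : 0 < s) :
    Tendsto (fun a : ℝ => a * (1 - Real.exp (-(s / a)))) atTop (𝓝 s) := by
  have h1 : Tendsto (fun a : ℝ => s - s ^ 2 / (a + s)) atTop (𝓝 s) := by
    have h2 : Tendsto (fun a : ℝ => s ^ 2 / (a + s)) atTop (𝓝 0) :=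
      tendsto_const_nhds.div_atTop (tendsto_atTop_add_const_right _ s tendsto_id)
    simpa using h2.const_sub s
  refine tendsto_of_tendsto_of_tendsto_of_le_of_le' h1 tendsto_const_nhds ?_ ?_
  · filter_upwards [eventually_gt_atTop 0] with a ha
    refine le_trans (le_of_eq ?_) (le_mul_one_sub_exp a s ha hs)
    field_simp
    ring
  · filter_upwards [eventually_gt_atTop 0] with a ha using mul_one_sub_exp_le a s ha

/-! ### Integrability of the kernel composed with the sine. -/

/-- A function which is antitone and continuous on `(0, ∞)` and integrable near `0` remains
integrable after composition with `c sin`. -/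
theorem intervalIntegrable_comp_mul_sin (K : ℝ → ℝ) (hK : AntitoneOn K (Ioi 0))
    (hcont : ContinuousOn K (Ioi 0)) (hint : IntegrableOn K (Ioo 0 1)) (c : ℝ) (hc : 0 < c) :
    IntervalIntegrable (fun u => K (c * Real.sin u)) volume 0 Real.pi := by
  have hR : ∀ R, 0 < R → IntervalIntegrable K volume 0 R := by
    intro R hR
    have h01 : IntervalIntegrable K volume 0 1 := by
      rw [intervalIntegrable_iff_integrableOn_Ioo_of_le zero_le_one]
      exact hint
    refine h01.trans (ContinuousOn.intervalIntegrable (hcont.mono ?_))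
    intro x hx
    exact (lt_min one_pos hR).trans_le hx.1
  have hhalf : IntervalIntegrable (fun u => K (c * Real.sin u)) volume 0 (Real.pi / 2) := by
    -- Jordan's inequality $\sin u\ge 2u/\pi$ on $[0,\pi/2]$ and antitonicity reduce the claim to a
    -- linear change of variable.
    have hd : 0 < c * (2 / Real.pi) := by positivity
    have h1 : IntervalIntegrable (fun u => K (c * (2 / Real.pi) * u)) volume 0 (Real.pi / 2) := by
      have h := (hR (c * (2 / Real.pi) * (Real.pi / 2)) (by positivity)).comp_mul_left
        (c := c * (2 / Real.pi))
      simpa [mul_div_cancel_left₀ _ hd.ne'] using h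
    refine ((h1.abs.add (intervalIntegrable_const (c := |K c|))).mono_fun ?_ ?_)
    · rw [uIoc_of_le (by positivity)]
      refine ContinuousOn.aestronglyMeasurable (hcont.comp (by fun_prop) fun u hu => ?_)
        measurableSet_Ioc
      exact mul_pos hc (Real.sin_pos_of_pos_of_lt_pi hu.1 (by linarith [hu.2, Real.pi_pos]))
    · rw [uIoc_of_le (by positivity)]
      refine (ae_restrict_iff' measurableSet_Ioc).2 (ae_of_all _ fun u hu => ?_)
      have hs := Real.mul_le_sin hu.1.le hu.2
      have hs0 : 0 < Real.sin u :=
        Real.sin_pos_of_pos_of_lt_pi hu.1 (by linarith [hu.2, Real.pi_pos])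
      have hu0 : 0 < 2 / Real.pi * u := mul_pos (by positivity) hu.1
      have hu1 : K (c * Real.sin u) ≤ K (c * (2 / Real.pi) * u) := by
        refine hK (mem_Ioi.2 ?_) (mul_pos hc hs0) ?_
        · rw [mul_assoc]
          positivity
        · rw [mul_assoc]
          gcongr
      have hu2 : K c ≤ K (c * Real.sin u) :=
        hK (mul_pos hc hs0) hc (by nlinarith [Real.sin_le_one u])
      simp only [Real.norm_eq_abs]
      refine le_trans ?_ (le_abs_self _)
      refine abs_le.2 ⟨?_, ?_⟩
      · linarith [neg_abs_le (K c), abs_nonneg (K (c * (2 / Real.pi) * u))]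
      · linarith [le_abs_self (K (c * (2 / Real.pi) * u)), abs_nonneg (K c)]
  refine hhalf.trans ?_
  have h2 := (hhalf.comp_sub_left Real.pi).symm
  simp only [Real.sin_pi_sub, sub_zero] at h2
  rwa [show Real.pi - Real.pi / 2 = Real.pi / 2 by ring] at h2

/-- Integrability of `K₀` near the origin. -/
theorem IntegrabilityAssumption.integrableOn {K₀ : ℝ → ℝ} (h : IntegrabilityAssumption K₀)
    (hcont : ContinuousOn K₀ (Ioi 0)) : IntegrableOn K₀ (Ioo 0 1) := by
  obtain ⟨α, h0, h1, hint⟩ := h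
  refine Integrable.mono hint ((hcont.mono Ioo_subset_Ioi_self).aestronglyMeasurable measurableSet_Ioo) ?_
  refine (ae_restrict_iff' measurableSet_Ioo).2 (ae_of_all _ fun t ht => ?_)
  -- The exponent is negative for $\alpha\in(0,1)$, so the weight only strengthens integrability on
  -- $(0,1)$.
  have h2 : 1 ≤ t ^ (-α + α ^ 2) :=
    Real.one_le_rpow_of_pos_of_le_one_of_nonpos ht.1 ht.2.le (by nlinarith)
  rw [norm_mul, Real.norm_eq_abs, Real.norm_eq_abs, abs_abs]
  exact le_mul_of_one_le_right (abs_nonneg _) (h2.trans (le_abs_self _))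

/-- A continuous function on `(0, ∞)` dominated by `|K(s)| + |K(s/2)|` is integrable after
composition with `c sin`. -/
theorem intervalIntegrable_comp_mul_sin_of_le (K f : ℝ → ℝ) (hK : AntitoneOn K (Ioi 0))
    (hcont : ContinuousOn K (Ioi 0)) (hint : IntegrableOn K (Ioo 0 1)) (c : ℝ) (hc : 0 < c)
    (hf : ContinuousOn f (Ioi 0)) (hle : ∀ s, 0 < s → s ≤ c → |f s| ≤ |K s| + |K (s / 2)|) :
    IntervalIntegrable (fun u => f (c * Real.sin u)) volume 0 Real.pi := by
  have h1 := intervalIntegrable_comp_mul_sin K hK hcont hint c hc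
  have h2 := intervalIntegrable_comp_mul_sin K hK hcont hint (c / 2) (by positivity)
  rw [intervalIntegrable_iff_integrableOn_Ioo_of_le Real.pi_pos.le] at *
  refine (h1.abs.add h2.abs).mono' (ContinuousOn.aestronglyMeasurable
    (hf.comp (by fun_prop) fun u hu => ?_) measurableSet_Ioo)
    ((ae_restrict_iff' measurableSet_Ioo).2 (ae_of_all _ fun u hu => ?_))
  · exact mul_pos hc (Real.sin_pos_of_pos_of_lt_pi hu.1 hu.2)
  · have hs : 0 < Real.sin u := Real.sin_pos_of_pos_of_lt_pi hu.1 hu.2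
    have h := hle (c * Real.sin u) (by positivity) (by nlinarith [Real.sin_le_one u])
    rwa [show c * Real.sin u / 2 = c / 2 * Real.sin u by ring] at h

/-! ### Lower bounds for differences of the coefficients $\lambda_{n,c}$. -/

theorem integral_cos_two_nat_mul (n : ℕ) (hn : 1 ≤ n) :
    ∫ u in (0 : ℝ)..Real.pi, Real.cos (2 * n * u) = 0 := by
  have h := expSinMoment_zero_zero n hn
  simpa [expSinMoment] using h

theorem abs_cos_sub_cos_le (x y : ℝ) : |Real.cos x - Real.cos y| ≤ 2 := by
  refine (abs_sub _ _).trans ?_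
  linarith [Real.abs_cos_le_one x, Real.abs_cos_le_one y]

theorem expSinMoment_sub_eq (n : ℕ) (a : ℝ) :
    expSinMoment n 0 a - expSinMoment (n + 1) 0 a = ∫ u in (0 : ℝ)..Real.pi,
      Real.exp (-(a * Real.sin u)) * (Real.cos (2 * n * u) - Real.cos (2 * (n + 1) * u)) := by
  simp only [expSinMoment]
  rw [← intervalIntegral.integral_sub (Continuous.intervalIntegrable (by fun_prop) _ _)
    (Continuous.intervalIntegrable (by fun_prop) _ _)]
  refine intervalIntegral.integral_congr fun u _ => ?_
  push_cast
  ring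

theorem eventually_ne_pi : ∀ᵐ u : ℝ, u ≠ Real.pi :=
  compl_mem_ae_iff.2 (measure_singleton Real.pi)

/-- The lower bound for the differences of Fourier coefficients, for the exponential
approximations of the kernel. -/
theorem CompleteMonotonicity.le_integral_approx {K₀ : ℝ → ℝ} (h : CompleteMonotonicity K₀)
    (hint : IntegrableOn K₀ (Ioo 0 1)) (c s₁ s₂ C : ℝ) (hc : 0 < c) (hs₁ : 0 < s₁)
    (hs : s₁ < s₂) (n : ℕ) (hn : 1 ≤ n)
    (hC : ∀ x : ℝ, 0 ≤ x → C * (Real.exp (-(x * s₁)) - Real.exp (-(x * s₂))) ≤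
      expSinMoment n 0 (2 * c * x) - expSinMoment (n + 1) 0 (2 * c * x))
    (a : ℝ) (hac : 2 * c ≤ a) :
    C * (K₀ (a * (1 - Real.exp (-(s₁ / a)))) - K₀ (a * (1 - Real.exp (-(s₂ / a))))) ≤
      ∫ u in (0 : ℝ)..Real.pi, K₀ (a * (1 - Real.exp (-(2 * c * Real.sin u / a)))) *
        (Real.cos (2 * n * u) - Real.cos (2 * (n + 1) * u)) := by
  have ha : 0 < a := by linarith
  obtain ⟨q, hq, hsum⟩ := h.exists_hasSum_exp a ha
  set H : ℝ → ℝ := fun s => K₀ (a * (1 - Real.exp (-(s / a)))) with hH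
  have hpos : ∀ s, 0 < s → 0 < a * (1 - Real.exp (-(s / a))) := fun s hs => by
    refine mul_pos ha (sub_pos.2 (Real.exp_lt_one_iff.2 ?_))
    simp only [Left.neg_neg_iff]
    positivity
  have hHc : ContinuousOn H (Ioi 0) := h.continuousOn.comp (by fun_prop) fun s hs => hpos s hs
  have hHint : IntervalIntegrable (fun u => H (2 * c * Real.sin u)) volume 0 Real.pi := by
    refine intervalIntegrable_comp_mul_sin_of_le K₀ H h.antitoneOn h.continuousOn hint (2 * c)
      (by positivity) hHc fun s hs hsc => ?_
    have h1 : K₀ s ≤ H s := h.antitoneOn (hpos s hs) hs (mul_one_sub_exp_le a s ha)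
    have h2 : H s ≤ K₀ (s / 2) := h.antitoneOn (half_pos hs) (hpos s hs)
      (half_le_mul_one_sub_exp a s ha hs (hsc.trans hac))
    refine abs_le.2 ⟨?_, ?_⟩
    · linarith [neg_abs_le (K₀ s), abs_nonneg (K₀ (s / 2))]
    · linarith [le_abs_self (K₀ (s / 2)), abs_nonneg (K₀ s)]
  set w : ℝ → ℝ := fun u => Real.cos (2 * n * u) - Real.cos (2 * (n + 1) * u) with hw
  have hwc : Continuous w := by fun_prop
  have hsin : ∀ᵐ u : ℝ, u ∈ uIoc 0 Real.pi → 0 < 2 * c * Real.sin u := by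
    filter_upwards [eventually_ne_pi] with u hu hu'
    rw [uIoc_of_le Real.pi_pos.le] at hu'
    have := Real.sin_pos_of_pos_of_lt_pi hu'.1 (lt_of_le_of_ne hu'.2 hu)
    positivity
  -- As the coefficients are nonnegative, the dominating series sums to $2(H(2c\sin u)-K_0(a))$,
  -- which is integrable.
  have hS := intervalIntegral.hasSum_integral_of_dominated_convergence (μ := volume)
    (a := 0) (b := Real.pi)
    (F := fun (j : ℕ) u => q j * Real.exp (-(j / a * (2 * c * Real.sin u))) * w u)
    (f := fun u => (H (2 * c * Real.sin u) - K₀ a) * w u)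
    (fun j u => q j * Real.exp (-(j / a * (2 * c * Real.sin u))) * 2)
    (fun j => Continuous.aestronglyMeasurable (by fun_prop))
    (fun j => ae_of_all _ fun u _ => by
      rw [norm_mul, Real.norm_of_nonneg (mul_nonneg (hq j) (Real.exp_pos _).le), Real.norm_eq_abs]
      exact mul_le_mul_of_nonneg_left (abs_cos_sub_cos_le _ _)
        (mul_nonneg (hq j) (Real.exp_pos _).le))
    (by
      filter_upwards [hsin] with u hu hu'
      exact ((hsum _ (hu hu')).summable).mul_right 2)
    ((((hHint.sub (intervalIntegrable_const (c := K₀ a))).mul_const 2)).congr_ae (by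
      refine (ae_restrict_iff' measurableSet_uIoc).2 ?_
      filter_upwards [hsin] with u hu hu'
      exact ((hsum _ (hu hu')).mul_right 2).tsum_eq.symm))
    (by
      filter_upwards [hsin] with u hu hu'
      exact (hsum _ (hu hu')).mul_right _)
  have hterm : ∀ j : ℕ, ∫ u in (0 : ℝ)..Real.pi,
      q j * Real.exp (-(j / a * (2 * c * Real.sin u))) * w u =
      q j * (expSinMoment n 0 (2 * c * (j / a)) - expSinMoment (n + 1) 0 (2 * c * (j / a))) := by
    intro j
    rw [expSinMoment_sub_eq, ← intervalIntegral.integral_const_mul]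
    refine intervalIntegral.integral_congr fun u _ => ?_
    simp only [hw]
    rw [mul_assoc, show (j : ℝ) / a * (2 * c * Real.sin u) = 2 * c * (j / a) * Real.sin u by ring]
  have hL := (((hsum s₁ hs₁).sub (hsum s₂ (hs₁.trans hs))).mul_left C)
  -- The $j$-th exponential is compared through `hC` at $x=j/a$; $q_j\ge0$ preserves the inequality.
  have hle := hasSum_le (fun j => by
    rw [hterm]
    have := mul_le_mul_of_nonneg_left (hC (j / a) (by positivity)) (hq j)
    linarith) hL hS
  -- The weight has mean zero because $n\ge1$, which removes the constant $K_0(a)$.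
  have hw0 : ∫ u in (0 : ℝ)..Real.pi, w u = 0 := by
    rw [intervalIntegral.integral_sub (Continuous.intervalIntegrable (by fun_prop) _ _)
      (Continuous.intervalIntegrable (by fun_prop) _ _), integral_cos_two_nat_mul n hn]
    have := integral_cos_two_nat_mul (n + 1) (by omega)
    push_cast at this
    rw [this, sub_zero]
  have hsplit : ∫ u in (0 : ℝ)..Real.pi, (H (2 * c * Real.sin u) - K₀ a) * w u =
      ∫ u in (0 : ℝ)..Real.pi, H (2 * c * Real.sin u) * w u := by
    simp only [sub_mul]
    rw [intervalIntegral.integral_sub (hHint.mul_continuousOn hwc.continuousOn)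
      (Continuous.intervalIntegrable (by fun_prop) _ _), intervalIntegral.integral_const_mul,
      hw0, mul_zero, sub_zero]
  rw [hsplit] at hle
  linarith

/-- The lower bound for the differences of Fourier coefficients of `u ↦ K₀(2c sin u)`. -/
theorem CompleteMonotonicity.le_integral {K₀ : ℝ → ℝ} (h : CompleteMonotonicity K₀)
    (hint : IntegrableOn K₀ (Ioo 0 1)) (c s₁ s₂ C : ℝ) (hc : 0 < c) (hs₁ : 0 < s₁)
    (hs : s₁ < s₂) (n : ℕ) (hn : 1 ≤ n)
    (hC : ∀ x : ℝ, 0 ≤ x → C * (Real.exp (-(x * s₁)) - Real.exp (-(x * s₂))) ≤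
      expSinMoment n 0 (2 * c * x) - expSinMoment (n + 1) 0 (2 * c * x)) :
    C * (K₀ s₁ - K₀ s₂) ≤ ∫ u in (0 : ℝ)..Real.pi, K₀ (2 * c * Real.sin u) *
      (Real.cos (2 * n * u) - Real.cos (2 * (n + 1) * u)) := by
  have hlim : ∀ s, 0 < s → Tendsto (fun a : ℝ => K₀ (a * (1 - Real.exp (-(s / a))))) atTop
      (𝓝 (K₀ s)) := fun s hs =>
    ((h.continuousOn.continuousAt (Ioi_mem_nhds hs)).tendsto).comp (tendsto_mul_one_sub_exp s hs)
  have h1 := intervalIntegrable_comp_mul_sin K₀ h.antitoneOn h.continuousOn hint (2 * c)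
    (by positivity)
  have h2 := intervalIntegrable_comp_mul_sin K₀ h.antitoneOn h.continuousOn hint c hc
  have hsin : ∀ᵐ u : ℝ, u ∈ uIoc 0 Real.pi → 0 < Real.sin u := by
    filter_upwards [eventually_ne_pi] with u hu hu'
    rw [uIoc_of_le Real.pi_pos.le] at hu'
    exact Real.sin_pos_of_pos_of_lt_pi hu'.1 (lt_of_le_of_ne hu'.2 hu)
  -- For $a\ge2c$ the argument lies between $c\sin u$ and $2c\sin u$, so antitonicity gives a bound
  -- independent of $a$.
  have hint_lim := intervalIntegral.tendsto_integral_filter_of_dominated_convergence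
    (μ := volume) (a := 0) (b := Real.pi) (l := (atTop : Filter ℝ))
    (F := fun a u => K₀ (a * (1 - Real.exp (-(2 * c * Real.sin u / a)))) *
        (Real.cos (2 * n * u) - Real.cos (2 * (n + 1) * u)))
    (f := fun u => K₀ (2 * c * Real.sin u) *
      (Real.cos (2 * n * u) - Real.cos (2 * (n + 1) * u)))
    (fun u => (|K₀ (2 * c * Real.sin u)| + |K₀ (c * Real.sin u)|) * 2)
    ?_ ?_ ((h1.abs.add h2.abs).mul_const 2) ?_
  · refine le_of_tendsto_of_tendsto
      (((hlim s₁ hs₁).sub (hlim s₂ (hs₁.trans hs))).const_mul C) hint_lim ?_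
    filter_upwards [eventually_ge_atTop (2 * c)] with a ha
      using h.le_integral_approx hint c s₁ s₂ C hc hs₁ hs n hn hC a ha
  · filter_upwards [eventually_gt_atTop 0] with a ha
    rw [uIoc_of_le Real.pi_pos.le, ← Measure.restrict_congr_set Ioo_ae_eq_Ioc]
    refine ContinuousOn.aestronglyMeasurable (ContinuousOn.mul (h.continuousOn.comp
      (by fun_prop) fun u hu => ?_) (by fun_prop)) measurableSet_Ioo
    have := Real.sin_pos_of_pos_of_lt_pi hu.1 hu.2
    refine mul_pos ha (sub_pos.2 (Real.exp_lt_one_iff.2 ?_))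
    simp only [Left.neg_neg_iff]
    positivity
  · filter_upwards [eventually_ge_atTop (2 * c)] with a hac
    have ha : 0 < a := by linarith
    filter_upwards [hsin] with u hu hu'
    have hu0 := hu hu'
    have hs0 : 0 < 2 * c * Real.sin u := by positivity
    have hsa : 2 * c * Real.sin u ≤ a := by nlinarith [Real.sin_le_one u]
    have h4 := half_le_mul_one_sub_exp a _ ha hs0 hsa
    have h5 := mul_one_sub_exp_le a (2 * c * Real.sin u) ha
    rw [show 2 * c * Real.sin u / 2 = c * Real.sin u by ring] at h4
    have hs1 : 0 < c * Real.sin u := by positivity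
    have h6 := h.antitoneOn hs1 (hs1.trans_le h4) h4
    have h7 := h.antitoneOn (hs1.trans_le h4) hs0 h5
    rw [norm_mul, Real.norm_eq_abs, Real.norm_eq_abs]
    gcongr
    · refine abs_le.2 ⟨?_, ?_⟩
      · linarith [neg_abs_le (K₀ (2 * c * Real.sin u)), abs_nonneg (K₀ (c * Real.sin u))]
      · linarith [le_abs_self (K₀ (c * Real.sin u)), abs_nonneg (K₀ (2 * c * Real.sin u))]
    · exact abs_cos_sub_cos_le _ _
  · filter_upwards [hsin] with u hu hu'
    have hu0 := hu hu'
    exact (hlim (2 * c * Real.sin u) (by positivity)).mul_const _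

/-- Integrability is what allows the real part to pass inside the integral. -/
theorem fourierIntegral_eq_integral_cos (f : ℝ → ℝ) (n : ℕ)
    (hf : IntervalIntegrable f volume 0 (2 * Real.pi)) :
    fourierIntegral f n = ∫ η in (0 : ℝ)..(2 * Real.pi), f η * Real.cos (n * η) := by
  have hc : IntervalIntegrable (fun η : ℝ => (f η : ℂ) * Complex.exp (Complex.I * n * η)) volume
      0 (2 * Real.pi) :=
    IntervalIntegrable.mul_continuousOn ⟨hf.1.ofReal, hf.2.ofReal⟩ (by fun_prop)
  have h := Complex.reCLM.intervalIntegral_comp_comm hc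
  rw [fourierIntegral, ← Complex.reCLM_apply, ← h]
  refine intervalIntegral.integral_congr fun η _ => ?_
  have h1 : Complex.I * n * η = ((n * η : ℝ) : ℂ) * Complex.I := by
    push_cast
    ring
  simp only [Complex.reCLM_apply, Complex.re_ofReal_mul]
  rw [h1, Complex.exp_ofReal_mul_I_re]

theorem CompleteMonotonicity.intervalIntegrable_lam {K₀ : ℝ → ℝ} (h : CompleteMonotonicity K₀)
    (hint : IntegrableOn K₀ (Ioo 0 1)) (c : ℝ) (hc : 0 < c) :
    IntervalIntegrable (fun η => K₀ (2 * c * |Real.sin (η / 2)|)) volume 0 (2 * Real.pi) := by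
  have h1 := (intervalIntegrable_comp_mul_sin K₀ h.antitoneOn h.continuousOn hint (2 * c)
    (by positivity)).comp_mul_left (c := 2⁻¹)
  have h2 : IntervalIntegrable (fun η => K₀ (2 * c * Real.sin (2⁻¹ * η))) volume 0
      (2 * Real.pi) := by simpa [mul_comm] using h1
  refine h2.congr_ae ((ae_restrict_iff' measurableSet_uIoc).2 (ae_of_all _ fun η hη => ?_))
  rw [uIoc_of_le (by positivity)] at hη
  have : 0 ≤ Real.sin (η / 2) := Real.sin_nonneg_of_nonneg_of_le_pi (by linarith [hη.1])
    (by linarith [hη.2])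
  simp only
  rw [abs_of_nonneg this, inv_mul_eq_div]

theorem CompleteMonotonicity.lam_eq {K₀ : ℝ → ℝ} (h : CompleteMonotonicity K₀)
    (hint : IntegrableOn K₀ (Ioo 0 1)) (c : ℝ) (hc : 0 < c) (n : ℕ) :
    lam K₀ n c = 2 * ∫ u in (0 : ℝ)..Real.pi, K₀ (2 * c * Real.sin u) * Real.cos (2 * n * u) := by
  rw [lam, fourierIntegral_eq_integral_cos _ _ (h.intervalIntegrable_lam hint c hc)]
  have h1 := intervalIntegral.integral_comp_div (a := 0) (b := 2 * Real.pi) (c := 2)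
    (fun u => K₀ (2 * c * |Real.sin u|) * Real.cos (2 * n * u)) two_ne_zero
  rw [zero_div, mul_div_cancel_left₀ _ two_ne_zero, smul_eq_mul] at h1
  have h2 : ∫ u in (0 : ℝ)..Real.pi, K₀ (2 * c * |Real.sin u|) * Real.cos (2 * n * u) =
      ∫ u in (0 : ℝ)..Real.pi, K₀ (2 * c * Real.sin u) * Real.cos (2 * n * u) := by
    refine intervalIntegral.integral_congr fun u hu => ?_
    rw [uIcc_of_le Real.pi_pos.le] at hu
    rw [abs_of_nonneg (Real.sin_nonneg_of_mem_Icc hu)]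
  rw [← h2, ← h1]
  refine intervalIntegral.integral_congr fun u _ => ?_
  rw [show (2 : ℝ) * n * (u / 2) = n * u by ring]

/-- Quantitative strict monotonicity of `n ↦ λ_{n,c}`. -/
theorem CompleteMonotonicity.exists_le_lam_sub {K₀ : ℝ → ℝ} (h : CompleteMonotonicity K₀)
    (hint : IntegrableOn K₀ (Ioo 0 1)) (c : ℝ) (hc : 0 < c) :
    ∃ C : ℝ, 0 < C ∧ ∀ n : ℕ, 1 ≤ n → C / n ^ 3 ≤ lam K₀ n c - lam K₀ (n + 1) c := by
  obtain ⟨s₁, s₂, hs₁, hs, hK⟩ := h.exists_lt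
  obtain ⟨C, hC, hle⟩ := exists_exp_sub_exp_le_expSinMoment_sub c s₁ s₂ hc hs₁ hs
  refine ⟨2 * (C * (K₀ s₁ - K₀ s₂)), mul_pos two_pos (mul_pos hC (sub_pos.2 hK)),
    fun n hn => ?_⟩
  have h1 := h.le_integral hint c s₁ s₂ (C / n ^ 3) hc hs₁ hs n hn (hle n hn)
  have h2 := intervalIntegrable_comp_mul_sin K₀ h.antitoneOn h.continuousOn hint (2 * c)
    (by positivity)
  rw [h.lam_eq hint c hc, h.lam_eq hint c hc, ← mul_sub, ← intervalIntegral.integral_sub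
    (h2.mul_continuousOn (by fun_prop)) (h2.mul_continuousOn (by fun_prop))]
  simp only [mul_sub] at h1 ⊢
  push_cast
  have h3 : C / n ^ 3 * K₀ s₁ - C / n ^ 3 * K₀ s₂ = (C * K₀ s₁ - C * K₀ s₂) / n ^ 3 := by ring
  rw [h3] at h1
  rw [← mul_sub, mul_div_assoc]
  linarith

/-! ### Decay of Fourier coefficients. -/

/-- Fourier coefficients of periodic `C^k` functions are `O(n^{-k})`. -/
theorem exists_norm_integral_mul_exp_le (k : ℕ) (f : ℝ → ℂ) (hf : ContDiff ℝ k f)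
    (hper : Function.Periodic f (2 * Real.pi)) :
    ∃ P : ℝ, 0 ≤ P ∧ ∀ n : ℕ, 1 ≤ n →
      ‖∫ η in (0 : ℝ)..(2 * Real.pi), f η * Complex.exp (Complex.I * n * η)‖ ≤ P / n ^ k := by
  induction k generalizing f with
  | zero =>
    refine ⟨∫ η in (0 : ℝ)..(2 * Real.pi), ‖f η‖,
      intervalIntegral.integral_nonneg (by positivity) fun _ _ => norm_nonneg _, fun n _ => ?_⟩
    refine (intervalIntegral.norm_integral_le_integral_norm (by positivity)).trans (le_of_eq ?_)
    rw [pow_zero, div_one]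
    refine intervalIntegral.integral_congr fun η _ => ?_
    have h1 : Complex.I * n * η = ((n * η : ℝ) : ℂ) * Complex.I := by
      push_cast
      ring
    rw [norm_mul, h1, Complex.norm_exp_ofReal_mul_I, mul_one]
  | succ k ih =>
    have hdiff : Differentiable ℝ f := hf.differentiable (by simp)
    have hf' : ContDiff ℝ k (deriv f) := by
      have h := hf
      push_cast at h
      exact (contDiff_succ_iff_deriv.1 h).2.2
    have hper' : Function.Periodic (deriv f) (2 * Real.pi) := fun x => by
      rw [← deriv_comp_add_const]
      congr 1
      exact funext hper
    obtain ⟨P, hP0, hP⟩ := ih (deriv f) hf' hper'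
    refine ⟨P, hP0, fun n hn => ?_⟩
    have hn0 : (n : ℂ) ≠ 0 := by exact_mod_cast (by omega : n ≠ 0)
    have hIn : Complex.I * n ≠ 0 := mul_ne_zero Complex.I_ne_zero hn0
    have hexp : ∀ η : ℝ, HasDerivAt (fun η : ℝ => Complex.exp (Complex.I * n * η) /
        (Complex.I * n)) (Complex.exp (Complex.I * n * η)) η := by
      intro η
      have h := (((hasDerivAt_id (η : ℂ)).const_mul (Complex.I * n)).cexp.div_const
        (Complex.I * n)).comp_ofReal
      refine h.congr_deriv ?_
      simp only [id]
      field_simp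
    -- Each integration by parts gains a factor $1/n$; the boundary terms cancel by periodicity.
    have hparts := intervalIntegral.integral_mul_deriv_eq_deriv_mul (a := 0) (b := 2 * Real.pi)
      (fun η _ => (hdiff η).hasDerivAt) (fun η _ => hexp η)
      (hf'.continuous.intervalIntegrable _ _)
      (Continuous.intervalIntegrable (by fun_prop) _ _)
    have he : Complex.exp (Complex.I * n * (2 * Real.pi : ℝ)) = 1 := by
      rw [Complex.exp_eq_one_iff]
      exact ⟨n, by push_cast; ring⟩
    have hf0 : f (2 * Real.pi) = f 0 := by simpa using hper 0
    rw [hparts, he, hf0]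
    have h2 : ∫ η in (0 : ℝ)..(2 * Real.pi),
        deriv f η * (Complex.exp (Complex.I * n * η) / (Complex.I * n)) =
        (∫ η in (0 : ℝ)..(2 * Real.pi), deriv f η * Complex.exp (Complex.I * n * η)) /
          (Complex.I * n) := by
      rw [← intervalIntegral.integral_div]
      refine intervalIntegral.integral_congr fun η _ => ?_
      simp only [mul_div_assoc]
    rw [h2]
    simp only [Complex.ofReal_zero, mul_zero, Complex.exp_zero, sub_self, zero_sub, norm_neg,
      norm_div, norm_mul, Complex.norm_I, one_mul, Complex.norm_natCast]
    have hn' : (0 : ℝ) < n := by exact_mod_cast hn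
    rw [pow_succ, ← div_div]
    gcongr
    exact hP n hn

/-- The decay of `fourierIntegral` for periodic `C^k` functions. -/
theorem exists_abs_fourierIntegral_le (k : ℕ) (f : ℝ → ℝ) (hf : ContDiff ℝ k f)
    (hper : Function.Periodic f (2 * Real.pi)) :
    ∃ P : ℝ, 0 ≤ P ∧ ∀ n : ℕ, 1 ≤ n → |fourierIntegral f n| ≤ P / n ^ k := by
  obtain ⟨P, hP0, hP⟩ := exists_norm_integral_mul_exp_le k (fun η => (f η : ℂ))
    (Complex.ofRealCLM.contDiff.comp hf) (fun x => by simp [hper x])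
  exact ⟨P, hP0, fun n hn => (Complex.abs_re_le_norm _).trans (hP n hn)⟩

/-- The Riemann-Lebesgue lemma for `fourierIntegral`. -/
theorem tendsto_fourierIntegral (f : ℝ → ℝ) : Tendsto (fourierIntegral f) atTop (𝓝 0) := by
  -- No integrability is required: if `f` is not integrable, the integrals take the default value
  -- $0$.
  have h1 := Real.tendsto_integral_exp_smul_cocompact
    (fun η => (Ioc 0 (2 * Real.pi)).indicator (fun η => (f η : ℂ)) η)
  -- The character is $e^{-2\pi i\eta w}$, so the frequency $w=-n/(2\pi)$ yields $e^{in\eta}$.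
  have h2 : Tendsto (fun n : ℕ => -(n / (2 * Real.pi) : ℝ)) atTop (cocompact ℝ) := by
    refine Tendsto.mono_right ?_ atBot_le_cocompact
    exact tendsto_neg_atTop_atBot.comp
      (tendsto_natCast_atTop_atTop.atTop_div_const (by positivity))
  have h3 := (Complex.continuous_re.tendsto 0).comp (h1.comp h2)
  rw [Complex.zero_re] at h3
  refine h3.congr fun n => ?_
  simp only [Function.comp_apply, fourierIntegral]
  rw [intervalIntegral.integral_of_le (by positivity), ← integral_indicator measurableSet_Ioc]
  congr 2
  funext η
  by_cases hη : η ∈ Ioc 0 (2 * Real.pi)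
  · rw [indicator_of_mem hη, indicator_of_mem hη, Circle.smul_def, Real.fourierChar_apply,
      smul_eq_mul, mul_comm]
    congr 2
    push_cast
    have : (Real.pi : ℂ) ≠ 0 := by exact_mod_cast Real.pi_ne_zero
    field_simp
  · rw [indicator_of_notMem hη, indicator_of_notMem hη, smul_zero]

/-- The endpoints $b$ and $1$ lie only in the closure of the annulus, reached as limits along the
real segment. -/
theorem ofReal_mem_of_compactlyContained {D : Set ℂ} {b : ℝ} (hb0 : 0 < b) (hb1 : b < 1)
    (hbD : CompactlyContained (annulus b) D) (r : ℝ) (hr : r ∈ Icc b 1) : (r : ℂ) ∈ D := by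
  refine hbD.2 ?_
  rw [← closure_Ioo hb1.ne] at hr
  have h := image_closure_subset_closure_image Complex.continuous_ofReal
    (mem_image_of_mem (fun x : ℝ => (x : ℂ)) hr)
  refine closure_mono ?_ h
  rintro _ ⟨x, hx, rfl⟩
  have hx0 : 0 < x := hb0.trans hx.1
  simp [annulus, abs_of_pos hx0, hx.1, hx.2]

/-- The Fourier coefficients of `η ↦ K₁(x, r e^{iη})` are `O(n^{-4})`. -/
theorem RegularityAssumption.exists_abs_fourierIntegral_le {D : Set ℂ} {K₁ : ℂ → ℂ → ℝ}
    (h : RegularityAssumption D K₁) (hD : IsRadialDomain D) (x r : ℂ) (hx : x ∈ D)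
    (hr : r ∈ D) :
    ∃ P : ℝ, 0 ≤ P ∧ ∀ n : ℕ, 1 ≤ n →
      |fourierIntegral (fun η => K₁ x (r * Complex.exp (η * Complex.I))) n| ≤ P / n ^ 4 := by
  obtain ⟨k, hk, hK⟩ := h
  have hK4 : ContDiffOn ℝ (4 : ℕ) (fun z : ℂ × ℂ => K₁ z.1 z.2) (D ×ˢ D) :=
    hK.of_le (by exact_mod_cast hk)
  refine ActiveScalar.exists_abs_fourierIntegral_le 4 _ ?_ fun η => ?_
  · have hg : ContDiff ℝ (4 : ℕ) fun η : ℝ => (x, r * Complex.exp (η * Complex.I)) :=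
      contDiff_const.prodMk (contDiff_const.mul
        ((Complex.ofRealCLM.contDiff.mul contDiff_const).cexp))
    rw [← contDiffOn_univ] at hg ⊢
    refine hK4.comp hg fun η _ => ⟨hx, ?_⟩
    simp only
    rw [mul_comm]
    exact hD.rotation r hr η
  · push_cast
    rw [add_mul, Complex.exp_add, Complex.exp_two_pi_mul_I, mul_one]

/-- `λ̃_{n,b} = O(n^{-4})`. -/
theorem CompleteMonotonicity.exists_abs_lamTilde_le {K₀ : ℝ → ℝ} (h : CompleteMonotonicity K₀)
    (b : ℝ) (hb0 : 0 < b) (hb1 : b < 1) :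
    ∃ P : ℝ, 0 ≤ P ∧ ∀ n : ℕ, 1 ≤ n → |lamTilde K₀ n b| ≤ P / n ^ 4 := by
  -- Since $b<1$, the distance from $b$ to the unit circle stays positive, away from the
  -- singularities of the norm and of $K_0$.
  have hne : ∀ η : ℝ, (b : ℂ) - Complex.exp (η * Complex.I) ≠ 0 := by
    intro η h0
    have h1 := congrArg norm (sub_eq_zero.1 h0)
    rw [Complex.norm_exp_ofReal_mul_I, Complex.norm_real, Real.norm_of_nonneg hb0.le] at h1
    exact hb1.ne h1
  refine ActiveScalar.exists_abs_fourierIntegral_le 4 _ ?_ fun η => ?_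
  · have hg : ContDiff ℝ (4 : ℕ) fun η : ℝ => ‖(b : ℂ) - Complex.exp (η * Complex.I)‖ :=
      ContDiff.norm ℝ (contDiff_const.sub
        ((Complex.ofRealCLM.contDiff.mul contDiff_const).cexp)) hne
    rw [← contDiffOn_univ] at hg ⊢
    exact (contDiffOn_infty.1 h.contDiffOn 4).comp hg
      fun η _ => norm_pos_iff.2 (hne η)
  · push_cast
    rw [add_mul, Complex.exp_add, Complex.exp_two_pi_mul_I, mul_one]

/-! ### Perturbation of the roots of the dispersion equation. -/

/-- A perturbation of order `n^{-4}` does not destroy decrements of order `n^{-3}`. -/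
theorem eventually_le_sub_add {x δ : ℕ → ℝ} {C P : ℝ} (hC : 0 < C) (hP : 0 ≤ P)
    (hx : ∀ᶠ n : ℕ in atTop, C / n ^ 3 ≤ x n - x (n + 1))
    (hδ : ∀ᶠ n : ℕ in atTop, |δ n| ≤ P / n ^ 4) :
    ∀ᶠ n : ℕ in atTop, C / 2 / n ^ 3 ≤ (x n + δ n) - (x (n + 1) + δ (n + 1)) := by
  filter_upwards [hx, hδ, (tendsto_add_atTop_nat 1).eventually hδ,
    tendsto_natCast_atTop_atTop.eventually (eventually_ge_atTop (4 * P / C)),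
    eventually_ge_atTop 1] with n h1 h2 h3 h4 h5
  have hn : (1 : ℝ) ≤ n := by exact_mod_cast h5
  have h6 : P / ((n + 1 : ℕ) : ℝ) ^ 4 ≤ P / n ^ 4 := by
    push_cast
    gcongr
    linarith
  -- The two perturbations cost at most half of the decrement once $n\ge4P/C$.
  have h7 : 2 * (P / n ^ 4) ≤ C / 2 / n ^ 3 := by
    rw [div_le_iff₀ hC] at h4
    have : 2 * (P / (n : ℝ) ^ 4) = (4 * P) / 2 / n ^ 4 := by ring
    rw [this, pow_succ (n : ℝ) 3, mul_comm ((n : ℝ) ^ 3), ← div_div]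
    refine div_le_div_of_nonneg_right ?_ (by positivity)
    rw [div_le_iff₀ (by positivity)]
    linarith
  have h8 : C / (n : ℝ) ^ 3 = C / 2 / n ^ 3 + C / 2 / n ^ 3 := by ring
  have h9 := abs_le.1 h2
  have h10 := abs_le.1 (h3.trans h6)
  linarith [h9.1, h9.2, h10.1, h10.2]

/-- With $d=|X-Y|$ this is the distance of each root from the nearer of $X,Y$. It is quadratic in
$e$ because the square root lies between $d-4e^2/d$ and $d$. -/
theorem abs_sub_sqrt_div_two_le (d e : ℝ) (hd : 0 < d) (h : 4 * e ^ 2 ≤ d ^ 2) :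
    |(d - √(d ^ 2 - 4 * e ^ 2)) / 2| ≤ 2 * e ^ 2 / d := by
  have h1 : √(d ^ 2 - 4 * e ^ 2) ≤ d := by
    rw [Real.sqrt_le_left hd.le]
    nlinarith [sq_nonneg e]
  have h2 : d - 4 * e ^ 2 / d ≤ √(d ^ 2 - 4 * e ^ 2) := by
    refine Real.le_sqrt_of_sq_le ?_
    have h3 : d ^ 2 - 4 * e ^ 2 - (d - 4 * e ^ 2 / d) ^ 2 =
        4 * e ^ 2 * (d ^ 2 - 4 * e ^ 2) / d ^ 2 := by
      field_simp
      ring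
    have h4 : 0 ≤ 4 * e ^ 2 * (d ^ 2 - 4 * e ^ 2) / d ^ 2 := by
      have := sub_nonneg.2 h
      positivity
    linarith
  rw [abs_of_nonneg (by linarith)]
  have h5 : 2 * e ^ 2 / d = (4 * e ^ 2 / d) / 2 := by ring
  rw [h5]
  linarith

/-- If `d` has a positive limit and `ε = O(n^{-4})`, then `d² - 4ε²` is eventually positive and
`d - √(d² - 4ε²) = O(n^{-4})`. -/
theorem exists_eventually_abs_sub_sqrt_le {d ε : ℕ → ℝ} {L P : ℝ} (hL : 0 < L)
    (hd : Tendsto d atTop (𝓝 L)) (hε : ∀ᶠ n : ℕ in atTop, |ε n| ≤ P / n ^ 4) :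
    (∀ᶠ n in atTop, 0 < d n ^ 2 - 4 * ε n ^ 2) ∧
    ∃ Q : ℝ, 0 ≤ Q ∧ ∀ᶠ n : ℕ in atTop, |(d n - √(d n ^ 2 - 4 * ε n ^ 2)) / 2| ≤ Q / n ^ 4 := by
  have hε0 : Tendsto ε atTop (𝓝 0) := by
    have h1 : Tendsto (fun n : ℕ => P / (n : ℝ) ^ 4) atTop (𝓝 0) :=
      tendsto_const_nhds.div_atTop
        ((tendsto_pow_atTop (by norm_num)).comp tendsto_natCast_atTop_atTop)
    exact squeeze_zero_norm' hε h1
  have hdisc : Tendsto (fun n => d n ^ 2 - 4 * ε n ^ 2) atTop (𝓝 (L ^ 2)) := by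
    simpa using (hd.pow 2).sub ((hε0.pow 2).const_mul 4)
  have hpos : ∀ᶠ n in atTop, 0 < d n ^ 2 - 4 * ε n ^ 2 :=
    hdisc.eventually (lt_mem_nhds (by positivity))
  refine ⟨hpos, 4 * P ^ 2 / L, by positivity, ?_⟩
  filter_upwards [hpos, hε, hd.eventually (lt_mem_nhds (half_lt_self hL)),
    eventually_ge_atTop 1] with n h1 h2 h3 h4
  have hn : (1 : ℝ) ≤ n := by exact_mod_cast h4
  refine (abs_sub_sqrt_div_two_le (d n) (ε n) (by linarith) (by linarith)).trans ?_
  -- The square is in fact $O(n^{-8})$; only $O(n^{-4})$ is needed.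
  have h5 : ε n ^ 2 ≤ P ^ 2 / n ^ 4 := by
    calc ε n ^ 2 = |ε n| ^ 2 := (sq_abs _).symm
      _ ≤ (P / n ^ 4) ^ 2 := by gcongr
      _ = P ^ 2 / n ^ 4 / n ^ 4 := by ring
      _ ≤ P ^ 2 / n ^ 4 := div_le_self (by positivity) (one_le_pow₀ hn)
  calc 2 * ε n ^ 2 / d n ≤ 2 * (P ^ 2 / n ^ 4) / (L / 2) := by gcongr
    _ = 4 * P ^ 2 / L / n ^ 4 := by ring

theorem strictMonoOn_Ici_of_lt_succ {f : ℕ → ℝ} {N : ℕ} (h : ∀ n, N ≤ n → f n < f (n + 1)) :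
    StrictMonoOn f (Ici N) := by
  intro m hm n _ hmn
  induction n, hmn using Nat.le_induction with
  | base => exact h m hm
  | succ n hn ih =>
    have hNn : N ≤ n := (mem_Ici.1 hm).trans (by omega)
    exact (ih hNn).trans (h n hNn)

theorem strictAntiOn_Ici_of_succ_lt {f : ℕ → ℝ} {N : ℕ} (h : ∀ n, N ≤ n → f (n + 1) < f n) :
    StrictAntiOn f (Ici N) := by
  have h' := strictMonoOn_Ici_of_lt_succ (f := fun n => -f n) fun n hn => neg_lt_neg (h n hn)
  exact fun m hm n hn hmn => neg_lt_neg_iff.1 (h' hm hn hmn)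

theorem lt_of_strictMonoOn_Ici_of_tendsto {f : ℕ → ℝ} {N : ℕ} {L : ℝ}
    (h : StrictMonoOn f (Ici N)) (hL : Tendsto f atTop (𝓝 L)) (n : ℕ) (hn : N ≤ n) : f n < L := by
  have hn1 : N ≤ n + 1 := by omega
  refine (h hn hn1 n.lt_succ_self).trans_le (ge_of_tendsto hL ?_)
  filter_upwards [eventually_ge_atTop (n + 1)] with m hm using h.monotoneOn hn1 (hn1.trans hm) hm

theorem lt_of_strictAntiOn_Ici_of_tendsto {f : ℕ → ℝ} {N : ℕ} {L : ℝ}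
    (h : StrictAntiOn f (Ici N)) (hL : Tendsto f atTop (𝓝 L)) (n : ℕ) (hn : N ≤ n) : L < f n := by
  have hn1 : N ≤ n + 1 := by omega
  refine (le_of_tendsto hL ?_).trans_lt (h hn hn1 n.lt_succ_self)
  filter_upwards [eventually_ge_atTop (n + 1)] with m hm using h.antitoneOn hn1 (hn1.trans hm) hm

/-- Eventual strict monotonicity of `x + δ` when `x` has decrements of order `n^{-3}` and
`δ = O(n^{-4})`. -/
theorem eventually_succ_lt {x δ : ℕ → ℝ} {C P : ℝ} (hC : 0 < C) (hP : 0 ≤ P)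
    (hx : ∀ᶠ n : ℕ in atTop, C / n ^ 3 ≤ x n - x (n + 1))
    (hδ : ∀ᶠ n : ℕ in atTop, |δ n| ≤ P / n ^ 4) :
    ∀ᶠ n : ℕ in atTop, x (n + 1) + δ (n + 1) < x n + δ n := by
  filter_upwards [eventually_le_sub_add hC hP hx hδ, eventually_ge_atTop 1] with n h hn
  have hn : (0 : ℝ) < n := by exact_mod_cast hn
  have : 0 < C / 2 / (n : ℝ) ^ 3 := by positivity
  linarith

theorem tendsto_sqrt_discriminant {d ε : ℕ → ℝ} {L P : ℝ} (hL : 0 ≤ L)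
    (hd : Tendsto d atTop (𝓝 L)) (hε : ∀ᶠ n : ℕ in atTop, |ε n| ≤ P / n ^ 4) :
    Tendsto (fun n => √(d n ^ 2 - 4 * ε n ^ 2)) atTop (𝓝 L) := by
  have h1 : Tendsto (fun n : ℕ => P / (n : ℝ) ^ 4) atTop (𝓝 0) :=
    tendsto_const_nhds.div_atTop
      ((tendsto_pow_atTop (by norm_num)).comp tendsto_natCast_atTop_atTop)
  have h2 := ((hd.pow 2).sub (((squeeze_zero_norm' hε h1).pow 2).const_mul 4)).sqrt
  simpa [Real.sqrt_sq hL] using h2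

/-- The roots `p ≥ m` of `(Ω - X)(Ω - Y) + ε² = 0`: if `X` decreases to `u`, `Y` increases to `v`
with steps of order `n^{-3}` and `u < v`, then the lower root is eventually strictly decreasing to
`u` and the upper root is eventually strictly increasing to `v`. -/
theorem eventually_roots_of_lt {X Y ε : ℕ → ℝ} {u v C P : ℝ} (hC : 0 < C) (huv : u < v)
    (hX : Tendsto X atTop (𝓝 u)) (hY : Tendsto Y atTop (𝓝 v))
    (hXs : ∀ᶠ n : ℕ in atTop, C / n ^ 3 ≤ X n - X (n + 1))
    (hYs : ∀ᶠ n : ℕ in atTop, C / n ^ 3 ≤ Y (n + 1) - Y n)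
    (hε : ∀ᶠ n : ℕ in atTop, |ε n| ≤ P / n ^ 4) {S p m : ℕ → ℝ}
    (hS : S = fun n => √((X n - Y n) ^ 2 - 4 * ε n ^ 2))
    (hp : p = fun n => (X n + Y n) / 2 + S n / 2) (hm : m = fun n => (X n + Y n) / 2 - S n / 2) :
    (∀ᶠ n in atTop, 0 < (X n - Y n) ^ 2 - 4 * ε n ^ 2) ∧
    (∀ᶠ n in atTop, p n < p (n + 1)) ∧ Tendsto p atTop (𝓝 v) ∧
    (∀ᶠ n in atTop, m (n + 1) < m n) ∧ Tendsto m atTop (𝓝 u) := by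
  have hd : Tendsto (fun n => Y n - X n) atTop (𝓝 (v - u)) := hY.sub hX
  have hsq : ∀ n, (Y n - X n) ^ 2 = (X n - Y n) ^ 2 := fun n => by ring
  obtain ⟨hpos, Q, hQ0, hQ⟩ := exists_eventually_abs_sub_sqrt_le (sub_pos.2 huv) hd hε
  have hSlim := tendsto_sqrt_discriminant (sub_pos.2 huv).le hd hε
  simp only [hsq] at hpos hQ hSlim
  rw [← hS] at hSlim
  have h1 : m = fun n => X n + (Y n - X n - √((X n - Y n) ^ 2 - 4 * ε n ^ 2)) / 2 := by
    rw [hm, hS]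
    funext n
    ring
  -- The increasing root is negated so that the lemma on decreasing sequences applies to it.
  have h2 : ∀ n, -p n = -Y n + (Y n - X n - √((X n - Y n) ^ 2 - 4 * ε n ^ 2)) / 2 := by
    intro n
    rw [hp, hS]
    ring
  refine ⟨hpos, ?_, ?_, ?_, ?_⟩
  · have h := eventually_succ_lt (x := fun n => -Y n) hC hQ0
      (hYs.mono fun n hn => by linarith) hQ
    filter_upwards [h] with n hn
    rw [← h2, ← h2] at hn
    exact neg_lt_neg_iff.1 hn
  · rw [hp]
    convert ((hX.add hY).div_const 2).add (hSlim.div_const 2) using 2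
    ring
  · rw [h1]
    exact eventually_succ_lt hC hQ0 hXs hQ
  · rw [hm]
    convert ((hX.add hY).div_const 2).sub (hSlim.div_const 2) using 2
    ring

/-- The counterpart of `eventually_roots_of_lt` for `v < u`. -/
theorem eventually_roots_of_gt {X Y ε : ℕ → ℝ} {u v C P : ℝ} (hC : 0 < C) (huv : v < u)
    (hX : Tendsto X atTop (𝓝 u)) (hY : Tendsto Y atTop (𝓝 v))
    (hXs : ∀ᶠ n : ℕ in atTop, C / n ^ 3 ≤ X n - X (n + 1))
    (hYs : ∀ᶠ n : ℕ in atTop, C / n ^ 3 ≤ Y (n + 1) - Y n)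
    (hε : ∀ᶠ n : ℕ in atTop, |ε n| ≤ P / n ^ 4) {S p m : ℕ → ℝ}
    (hS : S = fun n => √((X n - Y n) ^ 2 - 4 * ε n ^ 2))
    (hp : p = fun n => (X n + Y n) / 2 + S n / 2) (hm : m = fun n => (X n + Y n) / 2 - S n / 2) :
    (∀ᶠ n in atTop, 0 < (X n - Y n) ^ 2 - 4 * ε n ^ 2) ∧
    (∀ᶠ n in atTop, p (n + 1) < p n) ∧ Tendsto p atTop (𝓝 u) ∧
    (∀ᶠ n in atTop, m n < m (n + 1)) ∧ Tendsto m atTop (𝓝 v) := by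
  have hd : Tendsto (fun n => X n - Y n) atTop (𝓝 (u - v)) := hX.sub hY
  obtain ⟨hpos, Q, hQ0, hQ⟩ := exists_eventually_abs_sub_sqrt_le (sub_pos.2 huv) hd hε
  have hSlim := tendsto_sqrt_discriminant (sub_pos.2 huv).le hd hε
  rw [← hS] at hSlim
  have h1 : p = fun n => X n + -((X n - Y n - √((X n - Y n) ^ 2 - 4 * ε n ^ 2)) / 2) := by
    rw [hp, hS]
    funext n
    ring
  have h2 : ∀ n, -m n = -Y n + -((X n - Y n - √((X n - Y n) ^ 2 - 4 * ε n ^ 2)) / 2) := by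
    intro n
    rw [hm, hS]
    ring
  have hQ' : ∀ᶠ n : ℕ in atTop,
      |-((X n - Y n - √((X n - Y n) ^ 2 - 4 * ε n ^ 2)) / 2)| ≤ Q / n ^ 4 := by
    simpa only [abs_neg] using hQ
  refine ⟨hpos, ?_, ?_, ?_, ?_⟩
  · rw [h1]
    exact eventually_succ_lt hC hQ0 hXs hQ'
  · rw [hp]
    convert ((hX.add hY).div_const 2).add (hSlim.div_const 2) using 2
    ring
  · have h := eventually_succ_lt (x := fun n => -Y n) hC hQ0
      (hYs.mono fun n hn => by linarith) hQ'
    filter_upwards [h] with n hn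
    rw [← h2, ← h2] at hn
    exact neg_lt_neg_iff.1 hn
  · rw [hm]
    convert ((hX.add hY).div_const 2).sub (hSlim.div_const 2) using 2
    ring

/-! ### Application to the kernel and conclusion. -/

/-- The sequences `λ_{n,c} + p_{n,c}` tend to `0` and have decrements of order `n^{-3}`. -/
theorem KernelAssumptions.exists_le_lam_add_p_sub {D : Set ℂ} {K₀ : ℝ → ℝ} {K₁ : ℂ → ℂ → ℝ}
    (hK : KernelAssumptions D K₀ K₁) (hD : IsRadialDomain D) (c : ℝ) (hc : 0 < c)
    (hcD : (c : ℂ) ∈ D) :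
    ∃ C : ℝ, 0 < C ∧ ∀ᶠ n : ℕ in atTop,
      C / n ^ 3 ≤ (lam K₀ n c + p K₁ n c) - (lam K₀ (n + 1) c + p K₁ (n + 1) c) := by
  obtain ⟨C, hC, hlam⟩ := hK.monotonicity.exists_le_lam_sub
    (hK.integrability.integrableOn hK.monotonicity.continuousOn) c hc
  obtain ⟨P, hP0, hP⟩ := hK.regularity.exists_abs_fourierIntegral_le hD c c hcD hcD
  exact ⟨C / 2, half_pos hC, eventually_le_sub_add (x := fun n => lam K₀ n c)
    (δ := fun n => p K₁ n c) hC hP0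
    ((eventually_ge_atTop 1).mono fun n hn => hlam n hn)
    ((eventually_ge_atTop 1).mono fun n hn => hP n hn)⟩

theorem tendsto_lam_add_p (K₀ : ℝ → ℝ) (K₁ : ℂ → ℂ → ℝ) (c : ℝ) :
    Tendsto (fun n => lam K₀ n c + p K₁ n c) atTop (𝓝 0) := by
  have h := (tendsto_fourierIntegral (fun η => K₀ (2 * c * |Real.sin (η / 2)|))).add
    (tendsto_fourierIntegral (fun η => K₁ c (c * Complex.exp (η * Complex.I))))
  rw [add_zero] at h
  exact h

/-- `λ̃_{n,b} + p̃_{n,b} = O(n^{-4})`. -/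
theorem KernelAssumptions.exists_abs_lamTilde_add_pTilde_le {D : Set ℂ} {K₀ : ℝ → ℝ}
    {K₁ : ℂ → ℂ → ℝ} (hK : KernelAssumptions D K₀ K₁) (hD : IsRadialDomain D) (b : ℝ)
    (hb0 : 0 < b) (hb1 : b < 1) (hbD : (b : ℂ) ∈ D) (h1D : (1 : ℂ) ∈ D) :
    ∃ P : ℝ, ∀ᶠ n : ℕ in atTop, |lamTilde K₀ n b + pTilde K₁ n b| ≤ P / n ^ 4 := by
  obtain ⟨P, -, hP⟩ := hK.monotonicity.exists_abs_lamTilde_le b hb0 hb1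
  obtain ⟨Q, -, hQ⟩ := hK.regularity.exists_abs_fourierIntegral_le hD b 1 hbD h1D
  simp only [one_mul] at hQ
  refine ⟨P + Q, (eventually_ge_atTop 1).mono fun n hn => ?_⟩
  rw [add_div]
  exact (abs_add_le _ _).trans (add_le_add (hP n hn) (hQ n hn))

end ActiveScalar

theorem mainTheorem5 (D : Set ℂ) (hD : ActiveScalar.IsRadialDomain D)
    (K₀ : ℝ → ℝ) (K₁ : ℂ → ℂ → ℝ) (hK : ActiveScalar.KernelAssumptions D K₀ K₁)
    (b : ℝ) (hb0 : 0 < b) (hb1 : b < 1)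
    (hbD : ActiveScalar.CompactlyContained (ActiveScalar.annulus b) D)
    (hV : ActiveScalar.V1 K₀ K₁ b - ActiveScalar.V2 K₀ K₁ b ≠ 0) :
    ∃ N : ℕ, 1 ≤ N ∧
      (∀ n, N ≤ n → 0 < ActiveScalar.discriminant K₀ K₁ n b) ∧
      (ActiveScalar.V2 K₀ K₁ b < ActiveScalar.V1 K₀ K₁ b →
        StrictMonoOn (fun n => ActiveScalar.OmegaPlus K₀ K₁ n b) (Set.Ici N) ∧
        Filter.Tendsto (fun n => ActiveScalar.OmegaPlus K₀ K₁ n b) Filter.atTop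
          (nhds (-ActiveScalar.V2 K₀ K₁ b)) ∧
        StrictAntiOn (fun n => ActiveScalar.OmegaMinus K₀ K₁ n b) (Set.Ici N) ∧
        Filter.Tendsto (fun n => ActiveScalar.OmegaMinus K₀ K₁ n b) Filter.atTop
          (nhds (-ActiveScalar.V1 K₀ K₁ b)) ∧
        ∀ n, N ≤ n →
          -ActiveScalar.V1 K₀ K₁ b < ActiveScalar.OmegaMinus K₀ K₁ n b ∧
          ActiveScalar.OmegaMinus K₀ K₁ n b ≤ ActiveScalar.OmegaMinus K₀ K₁ N b ∧
          ActiveScalar.OmegaMinus K₀ K₁ N b < ActiveScalar.OmegaPlus K₀ K₁ N b ∧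
          ActiveScalar.OmegaPlus K₀ K₁ N b ≤ ActiveScalar.OmegaPlus K₀ K₁ n b ∧
          ActiveScalar.OmegaPlus K₀ K₁ n b < -ActiveScalar.V2 K₀ K₁ b) ∧
      (ActiveScalar.V1 K₀ K₁ b < ActiveScalar.V2 K₀ K₁ b →
        StrictAntiOn (fun n => ActiveScalar.OmegaPlus K₀ K₁ n b) (Set.Ici N) ∧
        Filter.Tendsto (fun n => ActiveScalar.OmegaPlus K₀ K₁ n b) Filter.atTop
          (nhds (-ActiveScalar.V1 K₀ K₁ b)) ∧
        StrictMonoOn (fun n => ActiveScalar.OmegaMinus K₀ K₁ n b) (Set.Ici N) ∧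
        Filter.Tendsto (fun n => ActiveScalar.OmegaMinus K₀ K₁ n b) Filter.atTop
          (nhds (-ActiveScalar.V2 K₀ K₁ b)) ∧
        ∀ n, N ≤ n →
          ActiveScalar.OmegaMinus K₀ K₁ N b ≤ ActiveScalar.OmegaMinus K₀ K₁ n b ∧
          ActiveScalar.OmegaMinus K₀ K₁ n b < -ActiveScalar.V2 K₀ K₁ b ∧
          -ActiveScalar.V2 K₀ K₁ b < -ActiveScalar.V1 K₀ K₁ b ∧
          -ActiveScalar.V1 K₀ K₁ b < ActiveScalar.OmegaPlus K₀ K₁ n b ∧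
          ActiveScalar.OmegaPlus K₀ K₁ n b ≤ ActiveScalar.OmegaPlus K₀ K₁ N b) := by
  have hmem := ActiveScalar.ofReal_mem_of_compactlyContained hb0 hb1 hbD
  have hbmem : (b : ℂ) ∈ D := hmem b ⟨le_rfl, hb1.le⟩
  have h1mem : ((1 : ℝ) : ℂ) ∈ D := hmem 1 ⟨hb1.le, le_rfl⟩
  obtain ⟨C₁, hC₁, hα⟩ := hK.exists_le_lam_add_p_sub hD b hb0 hbmem
  obtain ⟨C₂, hC₂, hβ⟩ := hK.exists_le_lam_add_p_sub hD 1 one_pos h1mem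
  rw [Complex.ofReal_one] at h1mem
  obtain ⟨P, hP⟩ := hK.exists_abs_lamTilde_add_pTilde_le hD b hb0 hb1 hbmem h1mem
  -- A single decrement constant is needed for $A$ (radius $b$, decreasing) and $B$ (radius $1$,
  -- increasing because $\lambda$ enters with a minus sign).
  have hC : 0 < min C₁ C₂ := lt_min hC₁ hC₂
  have hA : ∀ᶠ n : ℕ in atTop, min C₁ C₂ / n ^ 3 ≤
      ActiveScalar.A K₀ K₁ n b - ActiveScalar.A K₀ K₁ (n + 1) b := hα.mono fun n hn => by
    have : min C₁ C₂ / (n : ℝ) ^ 3 ≤ C₁ / n ^ 3 := by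
      gcongr
      exact min_le_left _ _
    simp only [ActiveScalar.A]
    linarith
  have hB : ∀ᶠ n : ℕ in atTop, min C₁ C₂ / n ^ 3 ≤
      ActiveScalar.B K₀ K₁ (n + 1) b - ActiveScalar.B K₀ K₁ n b := hβ.mono fun n hn => by
    have : min C₁ C₂ / (n : ℝ) ^ 3 ≤ C₂ / n ^ 3 := by
      gcongr
      exact min_le_right _ _
    simp only [ActiveScalar.B]
    linarith
  have hAlim : Tendsto (fun n => ActiveScalar.A K₀ K₁ n b) atTop
      (𝓝 (-ActiveScalar.V1 K₀ K₁ b)) := by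
    simpa [ActiveScalar.A, add_assoc] using
      (ActiveScalar.tendsto_lam_add_p K₀ K₁ b).const_add (-ActiveScalar.V1 K₀ K₁ b)
  have hBlim : Tendsto (fun n => ActiveScalar.B K₀ K₁ n b) atTop
      (𝓝 (-ActiveScalar.V2 K₀ K₁ b)) := by
    simpa [ActiveScalar.B, sub_sub] using
      (ActiveScalar.tendsto_lam_add_p K₀ K₁ 1).const_sub (-ActiveScalar.V2 K₀ K₁ b)
  have hsep : ∀ n, 0 < ActiveScalar.discriminant K₀ K₁ n b →
      ActiveScalar.OmegaMinus K₀ K₁ n b < ActiveScalar.OmegaPlus K₀ K₁ n b := fun n hn => by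
    have := Real.sqrt_pos.2 hn
    simp only [ActiveScalar.OmegaMinus, ActiveScalar.OmegaPlus]
    linarith
  rcases lt_or_gt_of_ne (sub_ne_zero.1 hV) with hlt | hgt
  · obtain ⟨hpos, hp, hplim, hm, hmlim⟩ := ActiveScalar.eventually_roots_of_gt hC
      (neg_lt_neg hlt) hAlim hBlim hA hB hP
      (p := fun n => ActiveScalar.OmegaPlus K₀ K₁ n b)
      (m := fun n => ActiveScalar.OmegaMinus K₀ K₁ n b) rfl rfl rfl
    obtain ⟨N, hN⟩ := eventually_atTop.1 ((hpos.and (hp.and hm)).and (eventually_ge_atTop 1))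
    have hpN := ActiveScalar.strictAntiOn_Ici_of_succ_lt (N := N)
      (f := fun n => ActiveScalar.OmegaPlus K₀ K₁ n b) fun n hn => (hN n hn).1.2.1
    have hmN := ActiveScalar.strictMonoOn_Ici_of_lt_succ (N := N)
      (f := fun n => ActiveScalar.OmegaMinus K₀ K₁ n b) fun n hn => (hN n hn).1.2.2
    refine ⟨N, (hN N le_rfl).2, fun n hn => (hN n hn).1.1, fun h => absurd h hlt.not_gt,
      fun _ => ⟨hpN, hplim, hmN, hmlim, fun n hn => ⟨?_, ?_, neg_lt_neg hlt, ?_, ?_⟩⟩⟩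
    · exact hmN.monotoneOn (mem_Ici.2 le_rfl) hn hn
    · exact ActiveScalar.lt_of_strictMonoOn_Ici_of_tendsto hmN hmlim n hn
    · exact ActiveScalar.lt_of_strictAntiOn_Ici_of_tendsto hpN hplim n hn
    · exact hpN.antitoneOn (mem_Ici.2 le_rfl) hn hn
  · obtain ⟨hpos, hp, hplim, hm, hmlim⟩ := ActiveScalar.eventually_roots_of_lt hC
      (neg_lt_neg hgt) hAlim hBlim hA hB hP
      (p := fun n => ActiveScalar.OmegaPlus K₀ K₁ n b)
      (m := fun n => ActiveScalar.OmegaMinus K₀ K₁ n b) rfl rfl rfl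
    obtain ⟨N, hN⟩ := eventually_atTop.1 ((hpos.and (hp.and hm)).and (eventually_ge_atTop 1))
    have hpN := ActiveScalar.strictMonoOn_Ici_of_lt_succ (N := N)
      (f := fun n => ActiveScalar.OmegaPlus K₀ K₁ n b) fun n hn => (hN n hn).1.2.1
    have hmN := ActiveScalar.strictAntiOn_Ici_of_succ_lt (N := N)
      (f := fun n => ActiveScalar.OmegaMinus K₀ K₁ n b) fun n hn => (hN n hn).1.2.2
    refine ⟨N, (hN N le_rfl).2, fun n hn => (hN n hn).1.1,
      fun _ => ⟨hpN, hplim, hmN, hmlim, fun n hn => ⟨?_, ?_, hsep N (hN N le_rfl).1.1, ?_, ?_⟩⟩,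
      fun h => absurd h hgt.not_gt⟩
    · exact ActiveScalar.lt_of_strictAntiOn_Ici_of_tendsto hmN hmlim n hn
    · exact hmN.antitoneOn (mem_Ici.2 le_rfl) hn hn
    · exact hpN.monotoneOn (mem_Ici.2 le_rfl) hn hn
    · exact ActiveScalar.lt_of_strictMonoOn_Ici_of_tendsto hpN hplim n hn
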